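/- Let $K$ be a field. A dg $K[u]$-module ($\deg u=2$) is a cochain complex $(M^l,\partial)_{l\in\mathbb Z}$ of $K$-vector spaces, not necessarily bounded, with $K$-linear maps $u:M^l\to M^{l+2}$ such that $u\partial=\partial u$. Let $\mathsf{Ch}_K$ be the category of cochain complexes of $K$-vector spaces. For a dg $K[u]$-module $M$ let $\alpha M\in \mathsf{Ch}_K^{(\mathbb R,\le)}$ be the persistence dg module $r\mapsto \Sigma^{2\lfloor r\rfloor}M$, where $(\Sigma^{2i}M)^n=M^{n+2i}$, with structure maps $\Sigma^{2i}M\to\Sigma^{2j}M$ ($i\le j$ integers) given by multiplication by $u^{\,j-i}$. For a category $\mathcal C$, $F,G\in\mathcal C^{(\mathbb R,\le)}$ and a real number $\varepsilon\ge 0$, put $F^\varepsilon(a)=F(a+\varepsilon)$. $F$ and $G$ are $\varepsilon$-interleaved if there are $\varphi:F\to G^\varepsilon$ and $\psi:G\to F^\varepsilon$ such that $\psi^\varepsilon\varphi:F\to F^{2\varepsilon}$ and $\varphi^\varepsilon\psi:G\to G^{2\varepsilon}$ are the maps given by the structure maps of $F$ and $G$. Let $d_{\rm I}(F,G)\in[0,\infty]$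 be the infimum of the $\varepsilon$ for which $F$ and $G$ are $\varepsilon$-interleaved ($\infty$ if there is none). Weak equivalences in $\mathsf{Ch}_K$ are the quasi-isomorphisms, those in $\mathsf{Ch}_K^{(\mathbb R,\le)}$ are the pointwise quasi-isomorphisms, and $\mathrm{Ho}$ denotes localization at the weak equivalences. For $X,Y\in\mathsf{Ch}_K^{(\mathbb R,\le)}$ let $d_{\rm HC}(X,Y)$, $d_{\rm IHC}(X,Y)$ and $d_{\rm HI}(X,Y)$ be the infima in $[0,\infty]$ of the $\varepsilon\ge0$ such that, respectively: - the images of $X,Y$ in $\mathrm{Ho}(\mathsf{Ch}_K)^{(\mathbb R,\le)}$ are $\varepsilon$-interleaved; - $X,Y$ are $\varepsilon$-interleaved in $\mathrm{Ho}(\mathsf{Ch}_K^{(\mathbb R,\le)})$ (that is, morphisms $\varphi:X\to Y^\varepsilon$, $\psi:Y\to X^\varepsilon$ of this category exist with the same identities, where $(\ )^\varepsilon$ is the induced shift functor); - there are $X',Y'$, connected to $X$, $Y$ respectively by zigzags of weak equivalences, which are $\varepsilon$-interleaved in $\mathsf{Ch}_K^{(\mathbb R,\le)}$. For a graded $K[t]$-module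 $V$ ($\deg t=1$) let $\tilde V$ be the persistence vector space $r\mapsto V^{\lfloor r\rfloor}$ with structure maps the powers of $t$. For $k=0,1$ let $S^kH(M)$ be the graded $K[t]$-module with $(S^kH(M))^i=H^{2i+k}(M)$ and $t$ acting by $u$, and put $d^k_{\rm CohI}(M,N)=d_{\rm I}(\widetilde{S^kH(M)},\widetilde{S^kH(N)})$ (the even, resp. odd, cohomology interleaving distance). **Theorem.** For all dg $K[u]$-modules $M$ and $N$, $$d_{\rm HC}(\alpha M,\alpha N)=d_{\rm IHC}(\alpha M,\alpha N)=d_{\rm HI}(\alpha M,\alpha N)=\max\{d^0_{\rm CohI}(M,N),\,d^1_{\rm CohI}(M,N)\}.$$ Moreover, for $k=0,1$, if $S^kH(M)$ and $S^kH(N)$ are direct sums of interval modules (such as $\Sigma^{-a}K[t]$, with bar $[a,\infty)$, and $\Sigma^{-b}(K[t]/(t^c))$, with bar $[b,b+c)$) with barcodes $\mathcal B$ and $\mathcal B'$, then $d^k_{\rm CohI}(M,N)=d_{\rm I}(\chi(\mathcal B),\chi(\mathcal B'))$, where $\chi(\mathcal B)=\bigoplus_{J\in\mathcal B}\chi_J$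 and $\chi_J$ is $K$ on the interval $J$ and $0$ elsewhere. -/

import Mathlib

open CategoryTheory
open scoped NNReal ENNReal

universe u

noncomputable section

namespace Pers

/-! ### Interleavings of persistence objects -/

section Interleaving

universe v₁ u₁

variable {C : Type u₁} [Category.{v₁} C]

/-- The translation `T_ε : a ↦ a + ε` of the poset `(ℝ, ≤)`. -/
def transl (ε : ℝ≥0) : ℝ ⥤ ℝ :=
  Monotone.functor (f := fun a : ℝ => a + (ε : ℝ)) fun _ _ h => add_le_add_left h _

/-- The shift functor `F ↦ F^ε = F T_ε` on persistence objects. -/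
def shift (C : Type u₁) [Category.{v₁} C] (ε : ℝ≥0) : (ℝ ⥤ C) ⥤ (ℝ ⥤ C) :=
  (Functor.whiskeringLeft ℝ ℝ C).obj (transl ε)

/-- The natural transformation `F ⟶ F^{2ε} = (F^ε)^ε` given by the structure maps
`F(a) ⟶ F(a + ε + ε)` of `F`. -/
def structTwo (ε : ℝ≥0) (F : ℝ ⥤ C) : F ⟶ (shift C ε).obj ((shift C ε).obj F) where
  app a := F.map (homOfLE (by
    have h : (0 : ℝ) ≤ (ε : ℝ) := ε.2
    change a ≤ a + (ε : ℝ) + (ε : ℝ)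
    linarith))
  naturality a b f := by
    change F.map _ ≫ F.map _ = F.map _ ≫ F.map _
    rw [← F.map_comp, ← F.map_comp]
    rfl

/-- `F` and `G` are `ε`-interleaved in `C^(ℝ, ≤)`. -/
def Interleaved (ε : ℝ≥0) (F G : ℝ ⥤ C) : Prop :=
  ∃ (φ : F ⟶ (shift C ε).obj G) (ψ : G ⟶ (shift C ε).obj F),
    φ ≫ (shift C ε).map ψ = structTwo ε F ∧ ψ ≫ (shift C ε).map φ = structTwo ε G

/-- The interleaving distance `d_I`. -/
def dI (F G : ℝ ⥤ C) : ℝ≥0∞ :=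
  ⨅ (ε : ℝ≥0) (_ : Interleaved ε F G), (ε : ℝ≥0∞)

end Interleaving

/-! ### Interleavings up to homotopy

`M` is a category with a class `W` of weak equivalences; its homotopy category is the localization
of `M` at `W`. The weak equivalences of (the projective model structure on) `M^(ℝ, ≤)` are the
natural transformations which are pointwise in `W`. -/

section Homotopy

universe v₁ u₁

variable {M : Type u₁} [Category.{v₁} M] (W : MorphismProperty M)

/-- The pointwise weak equivalences in `M^(ℝ, ≤)`. -/
abbrev pwe : MorphismProperty (ℝ ⥤ M) := W.functorCategory ℝ

/-- `X ≃ X'`: there is a zigzag of weak equivalences in `M^(ℝ, ≤)` connecting `X` and `X'`. -/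
def WeaklyEquivalent (X X' : ℝ ⥤ M) : Prop :=
  Relation.EqvGen (fun A B : ℝ ⥤ M => ∃ f : A ⟶ B, pwe W f) X X'

/-- `X` and `Y` are `ε`-homotopy interleaved. -/
def HomotopyInterleaved (ε : ℝ≥0) (X Y : ℝ ⥤ M) : Prop :=
  ∃ X' Y' : ℝ ⥤ M, WeaklyEquivalent W X X' ∧ WeaklyEquivalent W Y Y' ∧ Interleaved ε X' Y'

/-- The homotopy category `Ho(M^(ℝ, ≤))`. -/
abbrev HoPers := (pwe W).Localization

lemma shift_inverts (ε : ℝ≥0) :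
    (pwe W).IsInvertedBy (shift M ε ⋙ (pwe W).Q) := fun _ _ f hf =>
  (pwe W).Q_inverts ((shift M ε).map f) fun j => hf ((transl ε).obj j)

/-- The functor induced on `Ho(M^(ℝ, ≤))` by the shift functor of `M^(ℝ, ≤)`. -/
def shiftHo (ε : ℝ≥0) : HoPers W ⥤ HoPers W :=
  Localization.lift (shift M ε ⋙ (pwe W).Q) (shift_inverts W ε) (pwe W).Q

/-- The compatibility of `shiftHo` with the shift functor of `M^(ℝ, ≤)`. -/
def shiftHoIso (ε : ℝ≥0) : (pwe W).Q ⋙ shiftHo W ε ≅ shift M ε ⋙ (pwe W).Q :=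
  Localization.fac (shift M ε ⋙ (pwe W).Q) (shift_inverts W ε) (pwe W).Q

/-- The shift of a morphism `X ⟶ Z` of `Ho(M^(ℝ, ≤))`, as a morphism `X^ε ⟶ Z^ε`. -/
def shiftHoMap (ε : ℝ≥0) {X Z : ℝ ⥤ M} (f : (pwe W).Q.obj X ⟶ (pwe W).Q.obj Z) :
    (pwe W).Q.obj ((shift M ε).obj X) ⟶ (pwe W).Q.obj ((shift M ε).obj Z) :=
  (shiftHoIso W ε).inv.app X ≫ (shiftHo W ε).map f ≫ (shiftHoIso W ε).hom.app Z

/-- `X` and `Y` are `ε`-interleaved in the homotopy category `Ho(M^(ℝ, ≤))`. -/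
def InterleavedInHo (ε : ℝ≥0) (X Y : ℝ ⥤ M) : Prop :=
  ∃ (φ : (pwe W).Q.obj X ⟶ (pwe W).Q.obj ((shift M ε).obj Y))
    (ψ : (pwe W).Q.obj Y ⟶ (pwe W).Q.obj ((shift M ε).obj X)),
    φ ≫ shiftHoMap W ε ψ = (pwe W).Q.map (structTwo ε X) ∧
    ψ ≫ shiftHoMap W ε φ = (pwe W).Q.map (structTwo ε Y)

/-- `X` and `Y` are `ε`-homotopy commutative interleaved: their images in `Ho(M)^(ℝ, ≤)` are
`ε`-interleaved. -/
def HomotopyCommInterleaved (ε : ℝ≥0) (X Y : ℝ ⥤ M) : Prop :=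
  Interleaved ε (X ⋙ W.Q) (Y ⋙ W.Q)

/-- The homotopy interleaving distance. -/
def dHI (X Y : ℝ ⥤ M) : ℝ≥0∞ :=
  ⨅ (ε : ℝ≥0) (_ : HomotopyInterleaved W ε X Y), (ε : ℝ≥0∞)

/-- The interleaving distance in the homotopy category. -/
def dIHC (X Y : ℝ ⥤ M) : ℝ≥0∞ :=
  ⨅ (ε : ℝ≥0) (_ : InterleavedInHo W ε X Y), (ε : ℝ≥0∞)

/-- The homotopy commutative interleaving distance. -/
def dHC (X Y : ℝ ⥤ M) : ℝ≥0∞ :=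
  ⨅ (ε : ℝ≥0) (_ : HomotopyCommInterleaved W ε X Y), (ε : ℝ≥0∞)

end Homotopy

/-! ### Functors on `(ℤ, ≤)` from their elementary steps -/

section Steps

universe v₁ u₁

variable {C : Type u₁} [Category.{v₁} C] {X : ℤ → C} (f : ∀ i, X i ⟶ X (i + 1))

/-- The composite of `k` consecutive steps `X i ⟶ X (i + 1) ⟶ ⋯ ⟶ X j`, where `j = i + k`. -/
def iter : ∀ (k : ℕ) (i j : ℤ), i + (k : ℤ) = j → (X i ⟶ X j)
  | 0, _, _, h => eqToHom (by rw [← h]; simp)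
  | k + 1, i, _, h => iter k i (i + k) rfl ≫ f (i + k) ≫ eqToHom (by rw [← h]; push_cast; ring_nf)

lemma iter_add (k l : ℕ) : ∀ (i j m : ℤ) (h : i + (k : ℤ) = j) (h' : j + (l : ℤ) = m)
    (h'' : i + ((k + l : ℕ) : ℤ) = m), iter f (k + l) i m h'' = iter f k i j h ≫ iter f l j m h' := by
  induction l with
  | zero =>
    intro i j m h h' h''
    obtain rfl : j = m := by simpa using h'
    simp [iter]
  | succ l ih =>
    intro i j m h h' h''
    subst h' h
    have key : ∀ (a b : ℤ) (hab : a = b) (h1 : i + ((k + l : ℕ) : ℤ) = a)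
        (h2 : i + (k : ℤ) + (l : ℤ) = b) (e1 : X (a + 1) = X (i + k + ((l + 1 : ℕ) : ℤ)))
        (e2 : X (b + 1) = X (i + k + ((l + 1 : ℕ) : ℤ))),
        iter f (k + l) i a h1 ≫ f a ≫ eqToHom e1 =
          iter f k i (i + k) rfl ≫ iter f l (i + k) b h2 ≫ f b ≫ eqToHom e2 := by
      intro a b hab h1 h2 e1 e2
      subst hab
      rw [ih i (i + k) a rfl h2 h1, Category.assoc]
    exact key _ _ (by push_cast; ring) rfl rfl _ _

/-- The functor `(ℤ, ≤) ⟶ C` with given objects and given maps `X i ⟶ X (i + 1)`. -/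
def ofSteps : ℤ ⥤ C where
  obj := X
  map {i j} h := iter f (j - i).toNat i j (by have := leOfHom h; omega)
  map_id i := by
    have key : ∀ (k : ℕ) (h : i + (k : ℤ) = i), iter f k i i h = 𝟙 (X i) := by
      intro k h
      obtain rfl : k = 0 := by omega
      simp [iter]
    exact key _ _
  map_comp {i j m} h h' := by
    have h1 := leOfHom h
    have h2 := leOfHom h'
    have key : ∀ (n : ℕ) (hn : i + (n : ℤ) = m), n = (j - i).toNat + (m - j).toNat →
        iter f n i m hn = iter f (j - i).toNat i j (by omega) ≫
          iter f (m - j).toNat j m (by omega) := by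
      rintro n hn rfl
      exact iter_add f _ _ _ _ _ _ _ _
    exact key _ _ (by omega)

end Steps

/-- The floor function `(ℝ, ≤) ⟶ (ℤ, ≤)`. -/
def floorFunctor : ℝ ⥤ ℤ := Monotone.functor (f := fun x : ℝ => ⌊x⌋) Int.floor_mono

/-! ### Graded and differential graded modules over a polynomial ring -/

/-- A `ℤ`-graded module over the polynomial ring `K[x]` with `deg x = e`. -/
structure GrPolyMod (K : Type u) [Field K] (e : ℤ) where
  /-- The homogeneous components. -/
  X : ℤ → ModuleCat.{u} K
  /-- Multiplication by the generator of the polynomial ring. -/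
  act : ∀ i : ℤ, X i ⟶ X (i + e)

/-- A dg `K[u]`-module, `deg u = 2`: a cochain complex of `K`-vector spaces `M^l`, `l ∈ ℤ`, with
linear maps `u : M^l ⟶ M^{l+2}` commuting with the differential. -/
structure DGPolyMod (K : Type u) [Field K] where
  /-- The underlying dg module. -/
  cx : CochainComplex (ModuleCat.{u} K) ℤ
  /-- Multiplication by `u`. -/
  act : ∀ l : ℤ, cx.X l ⟶ cx.X (l + 2)
  act_d : ∀ i j : ℤ, act i ≫ cx.d (i + 2) (j + 2) = cx.d i j ≫ act j

section

variable {K : Type u} [Field K]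

namespace GrPolyMod

/-- `K[t]`-modules graded with `deg t = 1`, as functors on `(ℤ, ≤)`: the structure map
`V^i ⟶ V^{i+1}` is multiplication by `t`. -/
def toPersZ (V : GrPolyMod K 1) : ℤ ⥤ ModuleCat.{u} K := ofSteps V.act

/-- The persistence vector space `r ↦ V^⌊r⌋` of a graded `K[t]`-module. -/
def toPersR (V : GrPolyMod K 1) : ℝ ⥤ ModuleCat.{u} K := floorFunctor ⋙ V.toPersZ

/-- The graded `K[t]`-module `S^k V`, with `(S^k V)^i = V^{2i+k}` and `t` acting by `u`. -/
def S (k : ℤ) (V : GrPolyMod K 2) : GrPolyMod K 1 where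
  X i := V.X (2 * i + k)
  act i := V.act (2 * i + k) ≫ eqToHom (congrArg V.X (by ring))

end GrPolyMod

namespace DGPolyMod

variable (M : DGPolyMod K)

/-- The dg module `Σ^{2i} M`, with `(Σ^{2i} M)^n = M^{n+2i}`. -/
def evenShift (i : ℤ) : CochainComplex (ModuleCat.{u} K) ℤ where
  X n := M.cx.X (n + 2 * i)
  d n m := M.cx.d (n + 2 * i) (m + 2 * i)
  shape n m h := M.cx.shape _ _ fun h' => h (by
    simp only [ComplexShape.up_Rel] at h' ⊢
    omega)
  d_comp_d' n m p _ _ := M.cx.d_comp_d _ _ _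

/-- Multiplication by `u`, as a map of dg modules `Σ^{2i} M ⟶ Σ^{2(i+1)} M`. -/
def step (i : ℤ) : M.evenShift i ⟶ M.evenShift (i + 1) where
  f n := M.act (n + 2 * i) ≫ (M.cx.XIsoOfEq (by ring)).hom
  comm' n m _ := by
    change (M.act _ ≫ _) ≫ M.cx.d _ _ = M.cx.d _ _ ≫ M.act _ ≫ _
    rw [Category.assoc, HomologicalComplex.XIsoOfEq_hom_comp_d, ← Category.assoc (M.cx.d _ _),
      ← M.act_d, Category.assoc, HomologicalComplex.d_comp_XIsoOfEq_hom]

/-- The persistence dg module `C(M)` over `(ℤ, ≤)`: `C(M)(i) = Σ^{2i} M`, and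
`C(M)(i) ⟶ C(M)(i+1)` is multiplication by `u`. -/
def C : ℤ ⥤ CochainComplex (ModuleCat.{u} K) ℤ := ofSteps M.step

/-- The persistence dg module `αM`, given by `(αM)(r) = Σ^{2⌊r⌋} M`. -/
def α : ℝ ⥤ CochainComplex (ModuleCat.{u} K) ℤ := floorFunctor ⋙ M.C

/-- Multiplication by `u` on three consecutive terms `M^{l-1} ⟶ M^l ⟶ M^{l+1}` of `M`. -/
def actSc (l : ℤ) : M.cx.sc' (l - 1) l (l + 1) ⟶ M.cx.sc' (l - 1 + 2) (l + 2) (l + 1 + 2) where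
  τ₁ := M.act (l - 1)
  τ₂ := M.act l
  τ₃ := M.act (l + 1)
  comm₁₂ := M.act_d _ _
  comm₂₃ := M.act_d _ _

/-- The cohomology `H(M)`, a graded `K[u]`-module. -/
def H : GrPolyMod K 2 where
  X l := M.cx.homology l
  act l :=
    (M.cx.homologyIsoSc' (l - 1) l (l + 1) (by simp) (by simp)).hom ≫
      ShortComplex.homologyMap (M.actSc l) ≫
        (M.cx.homologyIsoSc' (l - 1 + 2) (l + 2) (l + 1 + 2)
          (by rw [CochainComplex.prev]; ring) (by rw [CochainComplex.next]; ring)).inv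

end DGPolyMod

/-- The quasi-isomorphisms, i.e. the weak equivalences of `Ch_K`. -/
abbrev qis (K : Type u) [Field K] : MorphismProperty (CochainComplex (ModuleCat.{u} K) ℤ) :=
  HomologicalComplex.quasiIso (ModuleCat.{u} K) (ComplexShape.up ℤ)

/-- The cohomology interleaving distances: the even one for `k = 0`, the odd one for `k = 1`. -/
def dCohI (k : ℤ) (M N : DGPolyMod K) : ℝ≥0∞ :=
  dI (M.H.S k).toPersR (N.H.S k).toPersR

/-! ### Barcodes of graded `K[t]`-modules -/

section Interval

variable (K) {P : Type} [Preorder P]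

open Classical in
/-- The value of the interval module `χ_J` at `x`: it is `K` if `x ∈ J` and `0` otherwise. -/
def chiObj (J : Set P) (x : P) : Submodule K K := if x ∈ J then ⊤ else ⊥

open Classical in
/-- The structure map of `χ_J` from `x` to `y`: it is the identity if `x, y ∈ J` and `0`
otherwise. -/
def chiMap (J : Set P) (x y : P) : chiObj K J x →ₗ[K] chiObj K J y :=
  LinearMap.codRestrict _
    (if x ∈ J ∧ y ∈ J then (chiObj K J x).subtype else 0) (fun v => by
      by_cases h : x ∈ J ∧ y ∈ J
      · simp [chiObj, h]
      · simp [h])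

/-- The interval module `χ_J`. -/
def chi (J : Set P) (hJ : J.OrdConnected) : P ⥤ ModuleCat.{u} K where
  obj x := ModuleCat.of K (chiObj K J x)
  map {x y} _ := ModuleCat.ofHom (chiMap K J x y)
  map_id x := by
    ext v
    by_cases h : x ∈ J
    · simp [chiMap, h]
    · have hv : (v : K) = 0 := by
        have := v.2
        simpa [chiObj, h] using this
      simp [chiMap, h, hv]
  map_comp {x y z} f g := by
    ext v
    have hv : x ∉ J → (v : K) = 0 := fun h => by
      have := v.2
      simpa [chiObj, h] using this
    by_cases hx : x ∈ J
    · by_cases hz : z ∈ J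
      · have hy : y ∈ J := hJ.out hx hz ⟨leOfHom f, leOfHom g⟩
        simp [chiMap, hx, hy, hz]
      · simp [chiMap, hz]
    · have h0 : v = 0 := Subtype.ext (hv hx)
      rw [h0, map_zero, map_zero]

end Interval

/-- A family (with repetitions) of nonempty intervals of `ℤ`. The intervals `{i ∣ a ≤ i}` and
`{i ∣ b ≤ i < b + c}` stand for the summands `Σ^{-a} K[t]` and `Σ^{-b} (K[t]/(t^c))`, and for the
bars `[a, ∞)` and `[b, b + c)`. -/
structure Barcode where
  /-- The index set of the family. -/
  ι : Type u
  /-- The integer points of the bars. -/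
  supp : ι → Set ℤ
  nonempty : ∀ i, (supp i).Nonempty
  ordConnected : ∀ i, (supp i).OrdConnected

namespace Barcode

/-- The bar in `ℝ` with given integer points: the interval `{x ∣ ⌊x⌋ ∈ supp i}`. -/
def bar (B : Barcode.{u}) (i : B.ι) : Set ℝ := {x | ⌊x⌋ ∈ B.supp i}

lemma bar_ordConnected (B : Barcode.{u}) (i : B.ι) : (B.bar i).OrdConnected :=
  ⟨fun _ hx _ hy _ hz =>
    (B.ordConnected i).out hx hy ⟨Int.floor_mono hz.1, Int.floor_mono hz.2⟩⟩

/-- `B` is a barcode of the graded `K[t]`-module `V`: `V` is isomorphic to the direct sum of the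
interval modules with supports `B.supp i`. -/
def IsBarcodeOf (B : Barcode.{u}) (V : GrPolyMod K 1) : Prop :=
  Nonempty (V.toPersZ ≅ ∐ fun i : B.ι => chi K (B.supp i) (B.ordConnected i))

/-- The persistence vector space `χ(B)`, the direct sum of the interval modules of the bars. -/
def χ (K : Type u) [Field K] (B : Barcode.{u}) : ℝ ⥤ ModuleCat.{u} K :=
  ∐ fun i : B.ι => chi K (B.bar i) (B.bar_ordConnected i)

end Barcode

end

end Pers

end

/-!
All distances are compared through cohomology.

*Lower bound.* The cohomology functors factor through `Ho(Ch_K)`, so that a homotopy commutative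
interleaving of `αM` and `αN` induces interleavings of their cohomology in each degree. In degree
`k` the cohomology of `αM` is the persistence vector space of `S^k H(M)`
(`DGPolyMod.homologyFunctorIso`, `αHomologyIso`), which gives `dCohI k ≤ dHC`. The inequalities
`dHC ≤ dIHC ≤ dHI` are formal: `Ho(Ch_K^(ℝ, ≤))` maps to `Ho(Ch_K)^(ℝ, ≤)` compatibly with the
shifts (`hoToPers_shiftHoMap`), and a zigzag of weak equivalences becomes an isomorphism in
`Ho(Ch_K^(ℝ, ≤))`, compatible with the structure maps (`WeaklyEquivalent.exists_iso`).

*Upper bound.* The point is that `αM` is formal: it is connected by weak equivalences to its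
cohomology with zero differential (`weaklyEquivalent_zeroCx`). Complexes with zero differential are
interleaved degree by degree (`interleaved_zeroCx`), and the cohomology of `αM` in degree `2m + k`
is that in degree `k`, translated by `m`. Interleavings of the `S^k H` for `k = 0, 1` thus give an
interleaving of the cohomologies of `αM` and `αN` in `Ch_K^(ℝ, ≤)`.

Formality holds because the abelian category of functors from `(ℤ, ≤)` to vector spaces is
hereditary. A functor `V` is the cokernel of a monomorphism `resδ V` between free functors, the sums
of the `V j` placed at `j + 1` and at `j`: the relations say that a generator is identified with its
image one step later. Free functors are projective. Placing such resolutions of all cohomology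
objects of a complex in the appropriate degrees yields a complex `sumCx` of projectives, which maps
quasi-isomorphically to any complex with the given cohomology (`sumCx.exists_quasiIso`): generators
lift to cycles and relations lift to cochains bounding them. Applied to the given complex and to its
cohomology with zero differential, this produces the zigzag.

The statement on barcodes is the invariance of `dI` under isomorphism, because restriction along the
floor function preserves direct sums and takes `χ_J` to the interval module of `{x ∣ ⌊x⌋ ∈ J}`.
-/

noncomputable section

namespace Pers

/-! ### Permanence properties of interleavings -/

section Interleaving

universe v₁ u₁ v₂ u₂

variable {C : Type u₁} [Category.{v₁} C] {D : Type u₂} [Category.{v₂} D]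

lemma le_add_nnreal (ε : ℝ≥0) (a : ℝ) : a ≤ a + (ε : ℝ) + (ε : ℝ) := by
  have h : (0 : ℝ) ≤ (ε : ℝ) := ε.2
  linarith

/-- An interleaving in terms of the components `F(a) ⟶ G(a + ε)` and `G(a) ⟶ F(a + ε)`. -/
lemma interleaved_iff {ε : ℝ≥0} {F G : ℝ ⥤ C} : Interleaved ε F G ↔
    ∃ (φ : ∀ a : ℝ, F.obj a ⟶ G.obj (a + ε)) (ψ : ∀ a : ℝ, G.obj a ⟶ F.obj (a + ε)),
      ((∀ (a b : ℝ) (h : a ≤ b), F.map (homOfLE h) ≫ φ b =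
          φ a ≫ G.map (homOfLE (add_le_add_left h _))) ∧
        ∀ (a b : ℝ) (h : a ≤ b), G.map (homOfLE h) ≫ ψ b =
          ψ a ≫ F.map (homOfLE (add_le_add_left h _))) ∧
      (∀ a, φ a ≫ ψ (a + ε) = F.map (homOfLE (le_add_nnreal ε a))) ∧
      ∀ a, ψ a ≫ φ (a + ε) = G.map (homOfLE (le_add_nnreal ε a)) := by
  constructor
  · rintro ⟨φ, ψ, h₁, h₂⟩
    exact ⟨φ.app, ψ.app,
      ⟨fun a b h => φ.naturality (homOfLE h), fun a b h => ψ.naturality (homOfLE h)⟩,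
      fun a => NatTrans.congr_app h₁ a, fun a => NatTrans.congr_app h₂ a⟩
  · rintro ⟨φ, ψ, ⟨n₁, n₂⟩, h₁, h₂⟩
    exact ⟨⟨φ, fun a b f => n₁ a b (leOfHom f)⟩, ⟨ψ, fun a b f => n₂ a b (leOfHom f)⟩,
      by ext a; exact h₁ a, by ext a; exact h₂ a⟩

lemma Interleaved.of_iso {ε : ℝ≥0} {F F' G G' : ℝ ⥤ C} (e : F ≅ F') (e' : G ≅ G')
    (h : Interleaved ε F G) : Interleaved ε F' G' := by
  rw [interleaved_iff] at h ⊢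
  obtain ⟨φ, ψ, ⟨n₁, n₂⟩, h₁, h₂⟩ := h
  refine ⟨fun a => e.inv.app a ≫ φ a ≫ e'.hom.app _, fun a => e'.inv.app a ≫ ψ a ≫ e.hom.app _,
    ⟨fun a b h => ?_, fun a b h => ?_⟩, fun a => ?_, fun a => ?_⟩
  · rw [NatTrans.naturality_assoc, reassoc_of% n₁ a b h, Category.assoc, Category.assoc,
      NatTrans.naturality]
  · rw [NatTrans.naturality_assoc, reassoc_of% n₂ a b h, Category.assoc, Category.assoc,
      NatTrans.naturality]
  · simp only [Category.assoc, Iso.hom_inv_id_app_assoc]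
    rw [reassoc_of% h₁, NatTrans.naturality, Iso.inv_hom_id_app_assoc]
  · simp only [Category.assoc, Iso.hom_inv_id_app_assoc]
    rw [reassoc_of% h₂, NatTrans.naturality, Iso.inv_hom_id_app_assoc]

lemma dI_congr {F F' G G' : ℝ ⥤ C} (e : F ≅ F') (e' : G ≅ G') : dI F G = dI F' G' := by
  unfold dI
  congr! 3 with ε
  exact ⟨fun h => h.of_iso e e', fun h => h.of_iso e.symm e'.symm⟩

/-- Functors preserve interleavings. -/
lemma Interleaved.comp {ε : ℝ≥0} {F G : ℝ ⥤ C} (h : Interleaved ε F G) (H : C ⥤ D) :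
    Interleaved ε (F ⋙ H) (G ⋙ H) := by
  rw [interleaved_iff] at h ⊢
  obtain ⟨φ, ψ, ⟨n₁, n₂⟩, h₁, h₂⟩ := h
  refine ⟨fun a => H.map (φ a), fun a => H.map (ψ a), ⟨fun a b h => ?_, fun a b h => ?_⟩,
    fun a => ?_, fun a => ?_⟩
  · simp only [Functor.comp_map, ← H.map_comp, n₁ a b h]
  · simp only [Functor.comp_map, ← H.map_comp, n₂ a b h]
  · simp only [Functor.comp_map, ← H.map_comp, h₁ a]
  · simp only [Functor.comp_map, ← H.map_comp, h₂ a]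

lemma Interleaved.mono {ε ε' : ℝ≥0} (h : ε ≤ ε') {F G : ℝ ⥤ C} (hi : Interleaved ε F G) :
    Interleaved ε' F G := by
  rw [interleaved_iff] at hi ⊢
  obtain ⟨φ, ψ, ⟨n₁, n₂⟩, h₁, h₂⟩ := hi
  have le : ∀ a : ℝ, a + (ε : ℝ) ≤ a + (ε' : ℝ) := fun a => by
    have h' : (ε : ℝ) ≤ (ε' : ℝ) := h
    linarith
  refine ⟨fun a => φ a ≫ G.map (homOfLE (le a)), fun a => ψ a ≫ F.map (homOfLE (le a)),
    ⟨fun a b h => ?_, fun a b h => ?_⟩, fun a => ?_, fun a => ?_⟩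
  · rw [reassoc_of% n₁ a b h, Category.assoc, ← G.map_comp, ← G.map_comp]
    rfl
  · rw [reassoc_of% n₂ a b h, Category.assoc, ← F.map_comp, ← F.map_comp]
    rfl
  · rw [Category.assoc, reassoc_of% n₂ _ _ (le a), reassoc_of% h₁, ← F.map_comp, ← F.map_comp]
    rfl
  · rw [Category.assoc, reassoc_of% n₁ _ _ (le a), reassoc_of% h₂, ← G.map_comp, ← G.map_comp]
    rfl

/-- The translation of `(ℝ, ≤)` by a real number. -/
def addFunctor (m : ℝ) : ℝ ⥤ ℝ :=
  Monotone.functor (f := fun a : ℝ => a + m) fun _ _ h => add_le_add_left h _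

/-- Interleavings are preserved by translations of the index poset. -/
lemma Interleaved.addFunctor_comp {ε : ℝ≥0} {F G : ℝ ⥤ C} (h : Interleaved ε F G) (m : ℝ) :
    Interleaved ε (addFunctor m ⋙ F) (addFunctor m ⋙ G) := by
  rw [interleaved_iff] at h
  obtain ⟨φ, ψ, ⟨n₁, n₂⟩, h₁, h₂⟩ := h
  have le : ∀ a : ℝ, a + m + (ε : ℝ) ≤ a + (ε : ℝ) + m := fun a => by linarith
  have nat : ∀ {F G : ℝ ⥤ C} (φ : ∀ a : ℝ, F.obj a ⟶ G.obj (a + ε))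
      (_ : ∀ (a b : ℝ) (h : a ≤ b), F.map (homOfLE h) ≫ φ b =
          φ a ≫ G.map (homOfLE (add_le_add_left h _))) (a b : ℝ) (h : a ≤ b),
      F.map (homOfLE (add_le_add_left h m)) ≫ φ (b + m) ≫ G.map (homOfLE (le b)) =
        (φ (a + m) ≫ G.map (homOfLE (le a))) ≫
          G.map (homOfLE (add_le_add_left (add_le_add_left h (ε : ℝ)) m)) := by
    intro F G φ n a b h
    rw [reassoc_of% n _ _ (add_le_add_left h m), Category.assoc, ← G.map_comp, ← G.map_comp]
    rfl
  have comp : ∀ {F G : ℝ ⥤ C} (φ : ∀ a : ℝ, F.obj a ⟶ G.obj (a + ε))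
      (ψ : ∀ a : ℝ, G.obj a ⟶ F.obj (a + ε))
      (_ : ∀ (a b : ℝ) (h : a ≤ b), G.map (homOfLE h) ≫ ψ b =
          ψ a ≫ F.map (homOfLE (add_le_add_left h _)))
      (_ : ∀ a, φ a ≫ ψ (a + ε) = F.map (homOfLE (le_add_nnreal ε a))) (a : ℝ),
      (φ (a + m) ≫ G.map (homOfLE (le a))) ≫ ψ (a + ε + m) ≫ F.map (homOfLE (le (a + ε))) =
        F.map (homOfLE (add_le_add_left (le_add_nnreal ε a) m)) := by
    intro F G φ ψ n h a
    rw [Category.assoc, reassoc_of% n _ _ (le a), reassoc_of% h, ← F.map_comp, ← F.map_comp]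
    rfl
  exact interleaved_iff.2 ⟨fun a => φ (a + m) ≫ G.map (homOfLE (le a)),
    fun a => ψ (a + m) ≫ F.map (homOfLE (le a)), ⟨nat φ n₁, nat ψ n₂⟩,
    comp φ ψ n₂ h₁, comp ψ φ n₁ h₂⟩

end Interleaving

/-! ### Comparison of the three notions of interleaving up to homotopy -/

section Homotopy

universe v₁ u₁

variable {M : Type u₁} [Category.{v₁} M] (W : MorphismProperty M)

lemma whiskeringRight_inverts :
    (pwe W).IsInvertedBy ((Functor.whiskeringRight ℝ M W.Localization).obj W.Q) :=
  fun _ _ f hf => by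
    rw [NatTrans.isIso_iff_isIso_app]
    exact fun a => W.Q_inverts (f.app a) (hf a)

/-- The functor `Ho(M^(ℝ, ≤)) ⥤ Ho(M)^(ℝ, ≤)`. -/
def hoToPers : HoPers W ⥤ (ℝ ⥤ W.Localization) :=
  Localization.lift ((Functor.whiskeringRight ℝ _ _).obj W.Q) (whiskeringRight_inverts W) (pwe W).Q

/-- On persistence objects, `hoToPers` is postcomposition with the localization functor. -/
def hoToPersIso : (pwe W).Q ⋙ hoToPers W ≅ (Functor.whiskeringRight ℝ _ _).obj W.Q :=
  Localization.fac _ (whiskeringRight_inverts W) (pwe W).Q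

/-- Shifting in `Ho(M^(ℝ, ≤))` and passing to `Ho(M)^(ℝ, ≤)` extends the functor
`X ↦ W.Q ∘ X^ε` to the localization. -/
instance liftingShiftHoLeft (ε : ℝ≥0) : Localization.Lifting (pwe W).Q (pwe W)
    (shift M ε ⋙ (Functor.whiskeringRight ℝ _ _).obj W.Q) (shiftHo W ε ⋙ hoToPers W) where
  iso := Functor.isoWhiskerRight (shiftHoIso W ε) (hoToPers W) ≪≫
    Functor.isoWhiskerLeft (shift M ε) (hoToPersIso W)

/-- Passing to `Ho(M)^(ℝ, ≤)` and shifting there extends the functor `X ↦ W.Q ∘ X^ε` to the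
localization. -/
instance liftingShiftHoRight (ε : ℝ≥0) : Localization.Lifting (pwe W).Q (pwe W)
    (shift M ε ⋙ (Functor.whiskeringRight ℝ _ _).obj W.Q)
    (hoToPers W ⋙ shift W.Localization ε) where
  iso := Functor.isoWhiskerRight (hoToPersIso W) (shift W.Localization ε)

/-- Two maps conjugate to `m` and `n` agree if the naturality square `h` of a transformation whose
components are composites of isomorphisms commutes. -/
lemma comp_eq_of_naturality {E : Type*} [Category* E] {p a a' b b' q r r' : E} (i : p ≅ a)
    (j : a ≅ a') (m : a' ⟶ b') (j' : b ≅ b') (i' : q ≅ b) (k : p ≅ r) (n : r ⟶ r') (k' : r' ≅ q)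
    (h : m ≫ j'.inv ≫ i'.inv ≫ k'.inv = (j.inv ≫ i.inv ≫ k.hom) ≫ n) :
    i.hom ≫ (j.hom ≫ m ≫ j'.inv) ≫ i'.inv = k.hom ≫ n ≫ k'.hom := by
  rw [← cancel_mono k'.inv]
  simp [h]

lemma comp_conj {E : Type*} [Category* E] {a b c d x y : E} (i : a ⟶ b) (f : b ⟶ c) (j : c ≅ d)
    (g : c ⟶ x) (k : x ⟶ y) : (i ≫ f ≫ j.hom) ≫ j.inv ≫ g ≫ k = i ≫ (f ≫ g) ≫ k := by
  simp

/-- `hoToPers` commutes with the shift functors on morphisms `Q X ⟶ Q Z` of `Ho(M^(ℝ, ≤))`, which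
need not come from maps `X ⟶ Z`. -/
lemma hoToPers_shiftHoMap (ε : ℝ≥0) {X Z : ℝ ⥤ M}
    (f : (pwe W).Q.obj X ⟶ (pwe W).Q.obj Z) :
    (hoToPersIso W).inv.app ((shift M ε).obj X) ≫ (hoToPers W).map (shiftHoMap W ε f) ≫
        (hoToPersIso W).hom.app ((shift M ε).obj Z) =
      (shift _ ε).map ((hoToPersIso W).inv.app X ≫ (hoToPers W).map f ≫
        (hoToPersIso W).hom.app Z) := by
  -- Both composites extend the same functor to the localization, hence are related by `β`.
  let β := Localization.liftNatTrans (pwe W).Q (pwe W)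
    (shift M ε ⋙ (Functor.whiskeringRight ℝ _ _).obj W.Q)
    (shift M ε ⋙ (Functor.whiskeringRight ℝ _ _).obj W.Q)
    (shiftHo W ε ⋙ hoToPers W) (hoToPers W ⋙ shift W.Localization ε) (𝟙 _)
  have hβ : ∀ X, β.app ((pwe W).Q.obj X) = (hoToPers W).map ((shiftHoIso W ε).hom.app X) ≫
      (hoToPersIso W).hom.app ((shift M ε).obj X) ≫
        (shift _ ε).map ((hoToPersIso W).inv.app X) := by
    intro X
    refine (Localization.liftNatTrans_app _ _ _ _ _ _ _ _).trans ?_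
    simp only [NatTrans.id_app]
    erw [Category.id_comp, Category.assoc]
    rfl
  have nat : (hoToPers W).map ((shiftHo W ε).map f) ≫ β.app ((pwe W).Q.obj Z) =
      β.app ((pwe W).Q.obj X) ≫ (shift _ ε).map ((hoToPers W).map f) := β.naturality f
  rw [hβ, hβ] at nat
  rw [shiftHoMap, Functor.map_comp, Functor.map_comp, Functor.map_comp, Functor.map_comp]
  exact comp_eq_of_naturality ((hoToPersIso W).symm.app ((shift M ε).obj X))
    ((hoToPers W).mapIso ((shiftHoIso W ε).symm.app X)) _
    ((hoToPers W).mapIso ((shiftHoIso W ε).symm.app Z))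
    ((hoToPersIso W).symm.app ((shift M ε).obj Z))
    ((shift W.Localization ε).mapIso ((hoToPersIso W).symm.app X)) _
    ((shift W.Localization ε).mapIso ((hoToPersIso W).app Z)) nat

lemma InterleavedInHo.homotopyCommInterleaved {ε : ℝ≥0} {X Y : ℝ ⥤ M}
    (h : InterleavedInHo W ε X Y) : HomotopyCommInterleaved W ε X Y := by
  obtain ⟨φ, ψ, h₁, h₂⟩ := h
  have key : ∀ {X Y : ℝ ⥤ M} (φ : (pwe W).Q.obj X ⟶ (pwe W).Q.obj ((shift M ε).obj Y))
      (ψ : (pwe W).Q.obj Y ⟶ (pwe W).Q.obj ((shift M ε).obj X))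
      (_ : φ ≫ shiftHoMap W ε ψ = (pwe W).Q.map (structTwo ε X)),
      ((hoToPersIso W).inv.app X ≫ (hoToPers W).map φ ≫
        (hoToPersIso W).hom.app ((shift M ε).obj Y)) ≫
      (shift _ ε).map ((hoToPersIso W).inv.app Y ≫ (hoToPers W).map ψ ≫
        (hoToPersIso W).hom.app ((shift M ε).obj X)) = structTwo ε (X ⋙ W.Q) := by
    intro X Y φ ψ h
    rw [← hoToPers_shiftHoMap]
    refine (comp_conj _ _ ((hoToPersIso W).app ((shift M ε).obj Y)) _ _).trans ?_
    rw [← Functor.map_comp, h]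
    exact NatIso.naturality_1 (hoToPersIso W) (structTwo ε X)
  exact ⟨_, _, key φ ψ h₁, key ψ φ h₂⟩

lemma dHC_le_dIHC (X Y : ℝ ⥤ M) : dHC W X Y ≤ dIHC W X Y :=
  le_iInf₂ fun ε h => iInf₂_le ε h.homotopyCommInterleaved

lemma shiftHoMap_comp (ε : ℝ≥0) {X Y Z : ℝ ⥤ M} (f : (pwe W).Q.obj X ⟶ (pwe W).Q.obj Y)
    (g : (pwe W).Q.obj Y ⟶ (pwe W).Q.obj Z) :
    shiftHoMap W ε (f ≫ g) = shiftHoMap W ε f ≫ shiftHoMap W ε g := by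
  simp [shiftHoMap]

lemma shiftHoMap_id (ε : ℝ≥0) (X : ℝ ⥤ M) : shiftHoMap W ε (𝟙 ((pwe W).Q.obj X)) = 𝟙 _ := by
  simp [shiftHoMap]

lemma shiftHoMap_Q_map (ε : ℝ≥0) {X Y : ℝ ⥤ M} (f : X ⟶ Y) :
    shiftHoMap W ε ((pwe W).Q.map f) = (pwe W).Q.map ((shift M ε).map f) := by
  have := (shiftHoIso W ε).hom.naturality f
  rw [Functor.comp_map, Functor.comp_map] at this
  rw [shiftHoMap, this, Iso.inv_hom_id_app_assoc]

lemma structTwo_naturality (ε : ℝ≥0) {F G : ℝ ⥤ M} (f : F ⟶ G) :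
    structTwo ε F ≫ (shift M ε).map ((shift M ε).map f) = f ≫ structTwo ε G := by
  ext a
  exact f.naturality _

/-- A zigzag of weak equivalences induces an isomorphism in the homotopy category which is
compatible with the structure maps. -/
lemma WeaklyEquivalent.exists_iso {X X' : ℝ ⥤ M} (h : WeaklyEquivalent W X X') (ε : ℝ≥0) :
    ∃ e : (pwe W).Q.obj X ≅ (pwe W).Q.obj X',
      (pwe W).Q.map (structTwo ε X) ≫ shiftHoMap W ε (shiftHoMap W ε e.hom) =
        e.hom ≫ (pwe W).Q.map (structTwo ε X') := by
  induction h with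
  | rel X X' h =>
    obtain ⟨f, hf⟩ := h
    have := (pwe W).Q_inverts f hf
    refine ⟨asIso ((pwe W).Q.map f), ?_⟩
    rw [asIso_hom, shiftHoMap_Q_map, shiftHoMap_Q_map, ← Functor.map_comp, ← Functor.map_comp,
      structTwo_naturality]
  | refl X => exact ⟨Iso.refl _, by simp [shiftHoMap_id]⟩
  | symm X X' _ ih =>
    obtain ⟨e, he⟩ := ih
    refine ⟨e.symm, ?_⟩
    rw [← cancel_epi e.hom, Iso.symm_hom, ← reassoc_of% he, ← shiftHoMap_comp, ← shiftHoMap_comp,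
      e.hom_inv_id, e.hom_inv_id_assoc, shiftHoMap_id, shiftHoMap_id, Category.comp_id]
  | trans X X' X'' _ _ ih ih' =>
    obtain ⟨e, he⟩ := ih
    obtain ⟨e', he'⟩ := ih'
    refine ⟨e ≪≫ e', ?_⟩
    rw [Iso.trans_hom, shiftHoMap_comp, shiftHoMap_comp, reassoc_of% he, he', Category.assoc]

lemma HomotopyInterleaved.interleavedInHo {ε : ℝ≥0} {X Y : ℝ ⥤ M}
    (h : HomotopyInterleaved W ε X Y) : InterleavedInHo W ε X Y := by
  obtain ⟨X', Y', hX, hY, φ, ψ, h₁, h₂⟩ := h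
  obtain ⟨e, he⟩ := hX.exists_iso W ε
  obtain ⟨e', he'⟩ := hY.exists_iso W ε
  have key : ∀ {X Y X' Y' : ℝ ⥤ M} (φ : X' ⟶ (shift M ε).obj Y') (ψ : Y' ⟶ (shift M ε).obj X')
      (_ : φ ≫ (shift M ε).map ψ = structTwo ε X')
      (e : (pwe W).Q.obj X ≅ (pwe W).Q.obj X') (e' : (pwe W).Q.obj Y ≅ (pwe W).Q.obj Y')
      (_ : (pwe W).Q.map (structTwo ε X) ≫ shiftHoMap W ε (shiftHoMap W ε e.hom) =
        e.hom ≫ (pwe W).Q.map (structTwo ε X')),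
      (e.hom ≫ (pwe W).Q.map φ ≫ shiftHoMap W ε e'.inv) ≫
        shiftHoMap W ε (e'.hom ≫ (pwe W).Q.map ψ ≫ shiftHoMap W ε e.inv) =
          (pwe W).Q.map (structTwo ε X) := by
    intro X Y X' Y' φ ψ h e e' he
    simp only [shiftHoMap_comp, Category.assoc]
    rw [← Category.assoc (shiftHoMap W ε e'.inv), ← shiftHoMap_comp, e'.inv_hom_id, shiftHoMap_id,
      Category.id_comp, shiftHoMap_Q_map, ← Functor.map_comp_assoc, h, ← reassoc_of% he,
      ← shiftHoMap_comp, ← shiftHoMap_comp, e.hom_inv_id, shiftHoMap_id, shiftHoMap_id,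
      Category.comp_id]
  exact ⟨_, _, key φ ψ h₁ e e' he, key ψ φ h₂ e' e he'⟩

lemma dIHC_le_dHI (X Y : ℝ ⥤ M) : dIHC W X Y ≤ dHI W X Y :=
  le_iInf₂ fun ε h => iInf₂_le ε h.interleavedInHo

end Homotopy

/-! ### Functors on `(ℤ, ≤)` -/

section Steps

universe v₁ u₁

variable {C : Type u₁} [Category.{v₁} C]

lemma int_le_succ (i : ℤ) : i ≤ i + 1 := by omega

/-- Over `(ℤ, ≤)`, naturality may be checked on the steps `i ⟶ i + 1`. -/
lemma naturality_of_steps {F G : ℤ ⥤ C} (φ : ∀ i, F.obj i ⟶ G.obj i)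
    (h : ∀ i : ℤ, F.map (homOfLE (int_le_succ i)) ≫ φ (i + 1) =
      φ i ≫ G.map (homOfLE (int_le_succ i))) {i j : ℤ} (f : i ⟶ j) :
    F.map f ≫ φ j = φ i ≫ G.map f := by
  obtain ⟨n, hn⟩ := Int.le.dest (leOfHom f)
  induction n generalizing j with
  | zero =>
    obtain rfl : i = j := by simpa using hn
    obtain rfl : f = 𝟙 i := Subsingleton.elim _ _
    simp
  | succ n ih =>
    obtain rfl : j = i + n + 1 := by rw [← hn]; push_cast; ring
    have le : i ≤ i + n := by omega
    obtain rfl : f = homOfLE le ≫ homOfLE (int_le_succ _) := Subsingleton.elim _ _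
    rw [F.map_comp, G.map_comp, Category.assoc, h, reassoc_of% ih (homOfLE le) rfl]

/-- A natural transformation of functors on `(ℤ, ≤)`, given by its components. -/
@[simps]
def natTransOfSteps {F G : ℤ ⥤ C} (φ : ∀ i, F.obj i ⟶ G.obj i)
    (h : ∀ i : ℤ, F.map (homOfLE (int_le_succ i)) ≫ φ (i + 1) =
      φ i ≫ G.map (homOfLE (int_le_succ i))) : F ⟶ G where
  app := φ
  naturality _ _ f := naturality_of_steps φ h f

/-- A natural isomorphism of functors on `(ℤ, ≤)`, given by its components. -/
def natIsoOfSteps {F G : ℤ ⥤ C} (φ : ∀ i, F.obj i ≅ G.obj i)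
    (h : ∀ i : ℤ, F.map (homOfLE (int_le_succ i)) ≫ (φ (i + 1)).hom =
      (φ i).hom ≫ G.map (homOfLE (int_le_succ i))) : F ≅ G :=
  NatIso.ofComponents φ (naturality_of_steps (fun i => (φ i).hom) h)

lemma ofSteps_map_step {X : ℤ → C} (f : ∀ i, X i ⟶ X (i + 1)) (i : ℤ) :
    (ofSteps f).map (homOfLE (int_le_succ i)) = f i := by
  have key : ∀ (n : ℕ) (h : i + (n : ℤ) = i + 1), n = 1 → iter f n i (i + 1) h = f i := by
    rintro n h rfl
    have key' : ∀ (j : ℤ) (e : i + ((0 : ℕ) : ℤ) = j) (e' : X (j + 1) = X (i + 1)), i = j →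
        iter f 0 i j e ≫ f j ≫ eqToHom e' = f i := by
      rintro j e e' rfl
      simp [iter]
    exact key' _ _ _ (by simp)
  exact key _ _ (by omega)

lemma ofSteps_map_of_eq {X : ℤ → C} (f : ∀ i, X i ⟶ X (i + 1)) {i j : ℤ} (h : i + 1 = j)
    (g : i ⟶ j) : (ofSteps f).map g = f i ≫ eqToHom (congrArg X h) := by
  subst h
  rw [eqToHom_refl, Category.comp_id]
  exact ofSteps_map_step f i

end Steps

/-! ### Free persistence objects -/

section Free

open Limits

universe v₁ u₁

variable {C : Type u₁} [Category.{v₁} C] [HasCoproducts.{0} C] {ι : Type} (c : ι → ℤ) (V : ι → C)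

/-- The free functor on `(ℤ, ≤)` on generating objects `V a` placed at `c a`: its value at `i` is
the coproduct of the `V a` with `c a ≤ i`. -/
def free : ℤ ⥤ C where
  obj i := ∐ fun a : {a : ι // c a ≤ i} => V a.1
  map {i j} f := Sigma.desc fun a =>
    Sigma.ι (fun a : {a : ι // c a ≤ j} => V a.1) ⟨a.1, a.2.trans (leOfHom f)⟩

variable {c V}

/-- The inclusion of the generators in the value at `i` of a free functor. -/
def free.incl (a : ι) {i : ℤ} (h : c a ≤ i) : V a ⟶ (free c V).obj i :=
  Sigma.ι (fun a : {a : ι // c a ≤ i} => V a.1) ⟨a, h⟩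

@[simp]
lemma free.incl_map (a : ι) {i j : ℤ} (h : c a ≤ i) (f : i ⟶ j) :
    free.incl a h ≫ (free c V).map f = free.incl (V := V) a (h.trans (leOfHom f)) :=
  Sigma.ι_desc _ _

lemma free.obj_hom_ext {i : ℤ} {T : C} {f g : (free c V).obj i ⟶ T}
    (h : ∀ (a : ι) (ha : c a ≤ i), free.incl a ha ≫ f = free.incl a ha ≫ g) : f = g :=
  Sigma.hom_ext _ _ fun a => h a.1 a.2

/-- Maps out of the value at `i` of a free functor. -/
def free.objDesc {i : ℤ} {T : C} (f : ∀ (a : ι), c a ≤ i → (V a ⟶ T)) : (free c V).obj i ⟶ T :=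
  Sigma.desc fun a => f a.1 a.2

@[simp]
lemma free.incl_objDesc {i : ℤ} {T : C} (f : ∀ (a : ι), c a ≤ i → (V a ⟶ T)) (a : ι)
    (h : c a ≤ i) : free.incl a h ≫ free.objDesc f = f a h :=
  Sigma.ι_desc _ _

/-- The universal property of free functors: maps `free c V ⟶ W` are given by maps
`V a ⟶ W (c a)`. -/
def free.desc {W : ℤ ⥤ C} (f : ∀ a, V a ⟶ W.obj (c a)) : free c V ⟶ W where
  app i := free.objDesc fun a h => f a ≫ W.map (homOfLE h)
  naturality i j g := free.obj_hom_ext fun a h => by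
    rw [← Category.assoc, free.incl_map, free.incl_objDesc, ← Category.assoc, free.incl_objDesc,
      Category.assoc, ← W.map_comp]
    rfl

@[simp]
lemma free.incl_desc_app {W : ℤ ⥤ C} (f : ∀ a, V a ⟶ W.obj (c a)) (a : ι) {i : ℤ} (h : c a ≤ i) :
    free.incl a h ≫ (free.desc f).app i = f a ≫ W.map (homOfLE h) :=
  free.incl_objDesc (fun a h => f a ≫ W.map (homOfLE h)) a h

lemma free.hom_ext {W : ℤ ⥤ C} {f g : free c V ⟶ W}
    (h : ∀ a, free.incl a le_rfl ≫ f.app (c a) = free.incl a le_rfl ≫ g.app (c a)) : f = g := by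
  ext i
  refine free.obj_hom_ext fun a ha => ?_
  have e : free.incl (V := V) a ha = free.incl a le_rfl ≫ (free c V).map (homOfLE ha) :=
    (free.incl_map a le_rfl (homOfLE ha)).symm
  rw [e, Category.assoc, Category.assoc, f.naturality, g.naturality, reassoc_of% h]

/-- Maps out of a free functor on projective objects lift through epimorphisms, since they are given
by maps out of the generators and epimorphisms of functors are pointwise. -/
lemma free.projective [Abelian C] (hV : ∀ a, Projective (V a)) : Projective (free c V) where
  factors {E X} f e _ := by
    have := fun a => hV a
    refine ⟨free.desc fun a => Projective.factorThru (free.incl a le_rfl ≫ f.app (c a))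
      (e.app (c a)), free.hom_ext fun a => ?_⟩
    rw [NatTrans.comp_app, ← Category.assoc, free.incl_desc_app, Category.assoc,
      NatTrans.naturality, ← Category.assoc, Projective.factorThru_comp, Category.assoc,
      ← f.naturality, ← Category.assoc, free.incl_map]

end Free

/-! ### Projective resolutions of length one -/

section Resolution

open Limits

universe v₁ u₁

variable {C : Type u₁} [Category.{v₁} C] [HasCoproducts.{0} C] (V : ℤ ⥤ C)

/-- The free functor on the objects `V j`, placed at `j`. -/
abbrev res₀ : ℤ ⥤ C := free (fun j : ℤ => j) V.obj

/-- The free functor on the objects `V j`, placed at `j + 1`. -/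
abbrev res₁ : ℤ ⥤ C := free (fun j : ℤ => j + 1) V.obj

/-- The canonical map from the free functor to `V`. -/
def resπ : res₀ V ⟶ V := free.desc fun _ => 𝟙 _

lemma incl_resπ (j : ℤ) {i : ℤ} (h : j ≤ i) :
    free.incl (V := V.obj) j h ≫ (resπ V).app i = V.map (homOfLE h) := by
  rw [resπ, free.incl_desc_app, Category.id_comp]

lemma incl_resπ_self (j : ℤ) :
    free.incl (V := V.obj) j (le_refl j) ≫ (resπ V).app j = 𝟙 (V.obj j) :=
  (incl_resπ V j le_rfl).trans (V.map_id j)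

variable [Abelian C]

/-- The map of free functors expressing that a generator `v` at `j`, moved to `j + 1`, is identified
with the generator at `j + 1` given by the image of `v`. -/
def resδ : res₁ V ⟶ res₀ V :=
  free.desc (W := res₀ V) fun j => free.incl j (int_le_succ j) -
    V.map (homOfLE (int_le_succ j)) ≫ free.incl (j + 1) le_rfl

lemma incl_resδ (j : ℤ) {i : ℤ} (h : j + 1 ≤ i) :
    free.incl j h ≫ (resδ V).app i = free.incl (V := V.obj) j ((int_le_succ j).trans h) -
      V.map (homOfLE (int_le_succ j)) ≫ free.incl (j + 1) h := by
  rw [resδ, free.incl_desc_app, Preadditive.sub_comp, Category.assoc, free.incl_map, free.incl_map]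

lemma resδ_resπ : resδ V ≫ resπ V = 0 := by
  refine free.hom_ext fun j => ?_
  rw [NatTrans.comp_app, ← Category.assoc, incl_resδ, Preadditive.sub_comp, Category.assoc,
    incl_resπ, incl_resπ, ← V.map_comp]
  simp

/-- `V` is the cokernel of `resδ V`: a map out of `res₀ V` which kills `resδ V` is a family of maps
out of the `V j` which is compatible with the steps `j ⟶ j + 1`. -/
def resIsCokernel : IsColimit (CokernelCofork.ofπ (resπ V) (resδ_resπ V)) :=
  CokernelCofork.IsColimit.ofπ _ _
    (fun {W} g hg => natTransOfSteps (fun j => free.incl j le_rfl ≫ g.app j) fun j => by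
      have := free.incl (V := V.obj) j (le_refl (j + 1)) ≫= NatTrans.congr_app hg (j + 1)
      rw [NatTrans.comp_app, ← Category.assoc, incl_resδ, Preadditive.sub_comp, NatTrans.app_zero,
        comp_zero, sub_eq_zero, Category.assoc] at this
      rw [← this, Category.assoc, ← g.naturality, ← Category.assoc, free.incl_map])
    (fun {W} g hg => free.hom_ext fun j => by
      rw [NatTrans.comp_app, ← Category.assoc, incl_resπ_self, Category.id_comp]
      rfl)
    (fun {W} g hg m hm => by
      ext j
      subst hm
      simp only [natTransOfSteps_app]
      rw [NatTrans.comp_app, ← Category.assoc, incl_resπ_self, Category.id_comp])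

/-- The contribution of the index `k` to the image of the generator at `j` under the left inverse
`resRetract V i`: for `j ≤ k < i`, the generator of `res₁ V` at `k + 1` given by the image of
`V j` in `V k`. -/
def resRetractComp (i j k : ℤ) : V.obj j ⟶ (res₁ V).obj i :=
  if h : j ≤ k ∧ k + 1 ≤ i then V.map (homOfLE h.1) ≫ free.incl k h.2 else 0

/-- A left inverse of `resδ V` at `i`. In `res₀ V`, a generator at `j ≤ i` differs from its image,
placed at `i`, by the telescoping sum of the relations coming from `j, …, i - 1`. -/
def resRetract (i : ℤ) : (res₀ V).obj i ⟶ (res₁ V).obj i :=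
  free.objDesc fun j _ => ∑ k ∈ Finset.Ico j i, resRetractComp V i j k

lemma resδ_resRetract (i : ℤ) : (resδ V).app i ≫ resRetract V i = 𝟙 _ := by
  refine free.obj_hom_ext fun j h => ?_
  have h' : j < i := by omega
  -- The sums for `j` and for `j + 1` differ by the term for `k = j`.
  have e : Finset.Ico j i = insert j (Finset.Ico (j + 1) i) := by
    ext
    simp only [Finset.mem_Ico, Finset.mem_insert]
    omega
  rw [← Category.assoc, incl_resδ, Preadditive.sub_comp, Category.assoc, resRetract,
    free.incl_objDesc, free.incl_objDesc, Category.comp_id, e, Finset.sum_insert (by simp),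
    Preadditive.comp_sum, Finset.sum_congr rfl fun k hk => ?_, add_sub_cancel_right]
  · rw [resRetractComp, dif_pos ⟨le_rfl, h⟩]
    exact (congrArg (· ≫ _) (V.map_id j)).trans (Category.id_comp _)
  · have hk' := Finset.mem_Ico.1 hk
    rw [resRetractComp, resRetractComp, dif_pos ⟨by omega, by omega⟩,
      dif_pos ⟨by omega, by omega⟩, ← Category.assoc, ← V.map_comp]
    rfl

instance : Mono (resδ V) := by
  have : ∀ i, Mono ((resδ V).app i) := fun i =>
    SplitMono.mono ⟨resRetract V i, resδ_resRetract V i⟩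
  exact NatTrans.mono_of_mono_app _

end Resolution

/-! ### Complexes with resolutions of length one of their cohomology -/

section Formality

open Limits

universe v₁ u₁

variable {A : Type u₁} [Category.{v₁} A] [Abelian A] (S : ℤ → ShortComplex A)

/-- The complex with `(S l).X₂ ⊞ (S (l + 1)).X₁` in degree `l`, i.e. the direct sum of the two-term
complexes `(S n).X₁ ⟶ (S n).X₂`, with `(S n).X₂` in degree `n`. -/
def sumCx : CochainComplex A ℤ :=
  CochainComplex.of (fun l => (S l).X₂ ⊞ (S (l + 1)).X₁)
    (fun l => biprod.snd ≫ (S (l + 1)).f ≫ biprod.inl) (fun l => by simp)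

/-- The summand `(S l).X₂` of `sumCx S` in degree `l`. -/
def sumCx.inl (l : ℤ) : (S l).X₂ ⟶ (sumCx S).X l := biprod.inl (Y := (S (l + 1)).X₁)

/-- The projection of `sumCx S` to its summand `(S l).X₂` in degree `l`. -/
def sumCx.fst (l : ℤ) : (sumCx S).X l ⟶ (S l).X₂ := biprod.fst (Y := (S (l + 1)).X₁)

/-- The projection of `sumCx S` to its summand `(S (l + 1)).X₁` in degree `l`. -/
def sumCx.snd (l : ℤ) : (sumCx S).X l ⟶ (S (l + 1)).X₁ := biprod.snd (X := (S l).X₂)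

/-- The inclusion of the summand `(S (l + 1)).X₁` of `sumCx S` in degree `l`. -/
def sumCx.inr (l : ℤ) : (S (l + 1)).X₁ ⟶ (sumCx S).X l := biprod.inr (X := (S l).X₂)

variable {S} in
/-- Maps out of `sumCx S` in degree `l`. -/
def sumCx.desc {l : ℤ} {T : A} (x : (S l).X₂ ⟶ T) (y : (S (l + 1)).X₁ ⟶ T) :
    (sumCx S).X l ⟶ T := biprod.desc x y

instance (l : ℤ) : Epi (sumCx.snd S l) := inferInstanceAs (Epi biprod.snd)

lemma sumCx.d_eq (l : ℤ) : (sumCx S).d l (l + 1) =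
    sumCx.snd S l ≫ (S (l + 1)).f ≫ sumCx.inl S (l + 1) :=
  CochainComplex.of_d (fun l => (S l).X₂ ⊞ (S (l + 1)).X₁)
    (fun l => biprod.snd ≫ (S (l + 1)).f ≫ biprod.inl) l

lemma sumCx.inl_fst (l : ℤ) : sumCx.inl S l ≫ sumCx.fst S l = 𝟙 _ := biprod.inl_fst

lemma sumCx.inl_desc {l : ℤ} {T : A} (x : (S l).X₂ ⟶ T) (y : (S (l + 1)).X₁ ⟶ T) :
    sumCx.inl S l ≫ sumCx.desc x y = x := biprod.inl_desc _ _

lemma sumCx.inr_desc {l : ℤ} {T : A} (x : (S l).X₂ ⟶ T) (y : (S (l + 1)).X₁ ⟶ T) :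
    sumCx.inr S l ≫ sumCx.desc x y = y := biprod.inr_desc _ _

lemma sumCx.inr_snd (l : ℤ) : sumCx.inr S l ≫ sumCx.snd S l = 𝟙 _ := biprod.inr_snd

variable {S} in
lemma sumCx.hom_ext {l : ℤ} {T : A} {x y : (sumCx S).X l ⟶ T}
    (h : sumCx.inl S l ≫ x = sumCx.inl S l ≫ y) (h' : sumCx.inr S l ≫ x = sumCx.inr S l ≫ y) :
    x = y := biprod.hom_ext' (X := (S l).X₂) (Y := (S (l + 1)).X₁) _ _ h h'

lemma sumCx.inl_snd (l : ℤ) : sumCx.inl S l ≫ sumCx.snd S l = 0 := biprod.inl_snd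

lemma sumCx.total (l : ℤ) {T : A} (k : T ⟶ (sumCx S).X l) (h : k ≫ sumCx.snd S l = 0) :
    (k ≫ sumCx.fst S l) ≫ sumCx.inl S l = k := by
  apply biprod.hom_ext (X := (S l).X₂) (Y := (S (l + 1)).X₁)
  · exact (Category.assoc _ _ _).trans ((congrArg _ (sumCx.inl_fst S l)).trans (Category.comp_id _))
  · refine (Category.assoc _ _ _).trans ((congrArg _ (sumCx.inl_snd S l)).trans ?_)
    exact comp_zero.trans h.symm

lemma sumCx.inl_d {j k : ℤ} (hjk : j + 1 = k) : sumCx.inl S j ≫ (sumCx S).d j k = 0 := by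
  subst hjk
  rw [sumCx.d_eq, ← Category.assoc, sumCx.inl_snd, zero_comp]

variable {S}

/-- The cycles of `sumCx S` lie in the summand `(S j).X₂`. -/
lemma sumCx.comp_fst_inl (hm : ∀ n, Mono (S n).f) {j k : ℤ} (hjk : j + 1 = k) {T : A}
    (x : T ⟶ (sumCx S).X j) (hx : x ≫ (sumCx S).d j k = 0) :
    (x ≫ sumCx.fst S j) ≫ sumCx.inl S j = x := by
  subst hjk
  have := hm (j + 1)
  refine sumCx.total S j x ?_
  have h := hx =≫ sumCx.fst S (j + 1)
  rw [sumCx.d_eq, Category.assoc, Category.assoc, Category.assoc, sumCx.inl_fst,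
    Category.comp_id, zero_comp, ← Category.assoc] at h
  exact (cancel_mono (S (j + 1)).f).1 (h.trans zero_comp.symm)

lemma sumCx.d_fst_comp_eq_zero_iff {i j : ℤ} (hij : i + 1 = j) {T : A} (x : (S j).X₂ ⟶ T) :
    ((sumCx S).d i j ≫ sumCx.fst S j) ≫ x = 0 ↔ (S j).f ≫ x = 0 := by
  subst hij
  rw [sumCx.d_eq, Category.assoc, Category.assoc, Category.assoc, ← Category.assoc (sumCx.inl _ _),
    sumCx.inl_fst, Category.id_comp, ← cancel_epi (sumCx.snd S i), comp_zero]

/-- If the `(S n).f` are monomorphisms with cokernel `(S n).g`, then the cycles of `sumCx S` in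
degree `j` are `(S j).X₂` and the cohomology is `(S j).X₃`. -/
def sumCx.leftHomologyData (hm : ∀ n, Mono (S n).f)
    (hS : ∀ n, IsColimit (CokernelCofork.ofπ (S n).g (S n).zero)) (i j k : ℤ) (hij : i + 1 = j)
    (hjk : j + 1 = k) : ((sumCx S).sc' i j k).LeftHomologyData where
  K := (S j).X₂
  H := (S j).X₃
  i := sumCx.inl S j
  π := (S j).g
  wi := sumCx.inl_d S hjk
  hi := KernelFork.IsLimit.ofι _ _ (fun x _ => x ≫ sumCx.fst S j)
    (fun x hx => sumCx.comp_fst_inl hm hjk x hx)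
    (fun x _ m hm => by
      subst hm
      exact ((Category.assoc _ _ _).trans
        ((congrArg _ (sumCx.inl_fst S j)).trans (Category.comp_id m))).symm)
  wπ := (sumCx.d_fst_comp_eq_zero_iff hij _).2 (S j).zero
  hπ := CokernelCofork.IsColimit.ofπ _ _
    (fun x hx => (hS j).desc (CokernelCofork.ofπ x ((sumCx.d_fst_comp_eq_zero_iff hij x).1 hx)))
    (fun x hx => (hS j).fac
      (CokernelCofork.ofπ x ((sumCx.d_fst_comp_eq_zero_iff hij x).1 hx)) WalkingParallelPair.one)
    (fun x hx m hm => Cofork.IsColimit.hom_ext (hS j) (hm.trans ((hS j).fac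
      (CokernelCofork.ofπ x ((sumCx.d_fst_comp_eq_zero_iff hij x).1 hx))
        WalkingParallelPair.one).symm))

/-- A map of short complexes is a quasi-isomorphism if the map it induces on cycles descends to an
isomorphism in homology. -/
lemma quasiIso_of_cycles_lift {S₁ S₂ : ShortComplex A} (φ : S₁ ⟶ S₂) (h₁ : S₁.LeftHomologyData)
    (h₂ : S₂.LeftHomologyData) (e : h₁.H ≅ h₂.H) (a : h₁.K ⟶ h₂.K) (hi : a ≫ h₂.i = h₁.i ≫ φ.τ₂)
    (hπ : h₁.π ≫ e.hom = a ≫ h₂.π) : ShortComplex.QuasiIso φ := by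
  let γ : ShortComplex.LeftHomologyMapData φ h₁ h₂ :=
    { φK := a
      φH := e.hom
      commi := hi
      commf' := by
        rw [← cancel_mono h₂.i, Category.assoc, Category.assoc, hi,
          ShortComplex.LeftHomologyData.f'_i, ← Category.assoc,
          ShortComplex.LeftHomologyData.f'_i, φ.comm₁₂]
      commπ := hπ }
  rw [γ.quasiIso_iff]
  exact e.isIso_hom

/-- If the `(S n).X₁` and `(S n).X₂` are projective, then `sumCx S` maps quasi-isomorphically to
every complex with cohomology `(S n).X₃`: the generators `(S n).X₂` lift to cycles, and the
relations `(S n).X₁` are then sent to boundaries. -/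
lemma sumCx.exists_quasiIso (hm : ∀ n, Mono (S n).f)
    (hS : ∀ n, IsColimit (CokernelCofork.ofπ (S n).g (S n).zero))
    (h₁ : ∀ n, Projective (S n).X₁) (h₂ : ∀ n, Projective (S n).X₂) (Y : CochainComplex A ℤ)
    (e : ∀ n, (S n).X₃ ≅ Y.homology n) : ∃ f : sumCx S ⟶ Y, QuasiIso f := by
  have ha : ∀ n, ∃ a : (S n).X₂ ⟶ Y.cycles n, a ≫ Y.homologyπ n = (S n).g ≫ (e n).hom := fun n =>
    ⟨Projective.factorThru ((S n).g ≫ (e n).hom) (Y.homologyπ n), Projective.factorThru_comp _ _⟩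
  choose a ha using ha
  have hb : ∀ n, ∃ b : (S (n + 1)).X₁ ⟶ Y.X n,
      b ≫ Y.toCycles n (n + 1) = (S (n + 1)).f ≫ a (n + 1) := fun n => by
    have hex : (ShortComplex.mk (Y.toCycles n (n + 1)) (Y.homologyπ (n + 1))
        (Y.toCycles_comp_homologyπ n (n + 1))).Exact :=
      ShortComplex.exact_of_g_is_cokernel _ (Y.homologyIsCokernel n (n + 1) (by simp))
    have h0 : ((S (n + 1)).f ≫ a (n + 1)) ≫ Y.homologyπ (n + 1) = 0 := by
      rw [Category.assoc, ha, ← Category.assoc, (S (n + 1)).zero, zero_comp]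
    exact ⟨hex.liftFromProjective _ h0, hex.liftFromProjective_comp _ _⟩
  choose b hb using hb
  have hπ : ∀ n, (S n).g ≫ (e n).hom ≫ (Y.sc n).leftHomologyIso.inv =
      a n ≫ (Y.sc n).leftHomologyπ := fun n =>
    (Category.assoc _ _ _).symm.trans ((congrArg (· ≫ (Y.sc n).leftHomologyIso.inv)
      (ha n).symm).trans ((Category.assoc _ _ _).trans
        (congrArg (a n ≫ ·) (Y.sc n).homologyπ_comp_leftHomologyIso_inv)))
  let f : sumCx S ⟶ Y :=
    { f := fun l => sumCx.desc (a l ≫ Y.iCycles l) (b l)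
      comm' := by
        rintro l _ rfl
        refine sumCx.hom_ext ?_ ?_
        · rw [← Category.assoc, sumCx.inl_desc, Category.assoc, Y.iCycles_d, comp_zero,
            ← Category.assoc, sumCx.inl_d S rfl, zero_comp]
        · rw [← Category.assoc, sumCx.inr_desc, sumCx.d_eq, Category.assoc, Category.assoc,
            sumCx.inl_desc, ← Category.assoc, sumCx.inr_snd, Category.id_comp, ← Category.assoc,
            ← hb, Category.assoc, Y.toCycles_i] }
  have hf : ∀ l, sumCx.inl S l ≫ f.f l = a l ≫ Y.iCycles l := fun l => sumCx.inl_desc S _ _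
  refine ⟨f, ⟨fun n => ?_⟩⟩
  rw [quasiIsoAt_iff]
  exact quasiIso_of_cycles_lift _ (sumCx.leftHomologyData hm hS ((ComplexShape.up ℤ).prev n) n
    ((ComplexShape.up ℤ).next n) (by simp) (by simp)) (Y.sc n).leftHomologyData
    (e n ≪≫ (Y.sc n).leftHomologyIso.symm) (a n) (hf n).symm (hπ n)

end Formality

/-! ### Formality of persistence complexes over `(ℤ, ≤)` -/

section Persistence

open Limits

universe v₁ u₁

/-- The complex with zero differential on a graded object. -/
def zeroCx {A : Type u₁} [Category.{v₁} A] [HasZeroMorphisms A] (V : ℤ → A) :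
    CochainComplex A ℤ where
  X := V
  d _ _ := 0

/-- The cohomology of a complex with zero differential. -/
def zeroCxHomologyIso {A : Type u₁} [Category.{v₁} A] [Abelian A] (V : ℤ → A) (n : ℤ) :
    V n ≅ (zeroCx V).homology n :=
  (ShortComplex.LeftHomologyData.ofZeros ((zeroCx V).sc n) rfl rfl).homologyIso.symm

variable {C : Type u₁} [Category.{v₁} C] [Abelian C]

/-- A functor from `(ℤ, ≤)` to complexes, as a complex of functors. -/
def complexOfFunctor (F : ℤ ⥤ CochainComplex C ℤ) : CochainComplex (ℤ ⥤ C) ℤ where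
  X n := F ⋙ HomologicalComplex.eval C (ComplexShape.up ℤ) n
  d i j :=
    { app := fun t => (F.obj t).d i j
      naturality := fun _ _ f => (F.map f).comm i j }
  shape i j h := by
    ext t
    exact (F.obj t).shape i j h
  d_comp_d' i j k _ _ := by
    ext t
    exact (F.obj t).d_comp_d i j k

/-- `complexOfFunctor` is a section of `HomologicalComplex.asFunctor`. -/
def asFunctorComplexOfFunctorIso (F : ℤ ⥤ CochainComplex C ℤ) :
    (complexOfFunctor F).asFunctor ≅ F :=
  NatIso.ofComponents (fun t => HomologicalComplex.Hom.isoOfComponents (fun n => Iso.refl _)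
    (fun i j _ => (Category.id_comp _).trans (Category.comp_id _).symm)) (fun f => by
      ext n
      exact (Category.comp_id _).trans (Category.id_comp _).symm)

/-- The cohomology of a complex of functors is computed pointwise. -/
def complexOfFunctorHomologyIso (F : ℤ ⥤ CochainComplex C ℤ) (n : ℤ) :
    F ⋙ HomologicalComplex.homologyFunctor C (ComplexShape.up ℤ) n ≅
      (complexOfFunctor F).homology n :=
  NatIso.ofComponents
    (fun t => ((complexOfFunctor F).sc n).mapHomologyIso ((evaluation ℤ C).obj t))
    (fun {s t} f => by
      have := NatTrans.app_homology ((evaluation ℤ C).map f) ((complexOfFunctor F).sc n)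
      exact ((Iso.eq_inv_comp _).1 this).symm)

/-- If all objects of `C` are projective, a complex of functors `ℤ ⥤ C` and its cohomology with zero
differential receive quasi-isomorphisms from a common complex. -/
lemma exists_roof [HasCoproducts.{0} C] (hC : ∀ X : C, Projective X)
    (F : ℤ ⥤ CochainComplex C ℤ) :
    ∃ (P : CochainComplex (ℤ ⥤ C) ℤ) (f : P ⟶ complexOfFunctor F)
      (g : P ⟶ zeroCx fun n =>
        F ⋙ HomologicalComplex.homologyFunctor C (ComplexShape.up ℤ) n),
      QuasiIso f ∧ QuasiIso g := by
  let V := fun n => F ⋙ HomologicalComplex.homologyFunctor C (ComplexShape.up ℤ) n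
  let S := fun n => ShortComplex.mk (resδ (V n)) (resπ (V n)) (resδ_resπ (V n))
  have hm : ∀ n, Mono (S n).f := fun n => inferInstanceAs (Mono (resδ (V n)))
  have h₁ : ∀ n, Projective (S n).X₁ := fun n => free.projective fun _ => hC _
  have h₂ : ∀ n, Projective (S n).X₂ := fun n => free.projective fun _ => hC _
  obtain ⟨f, hf⟩ := sumCx.exists_quasiIso hm (fun n => resIsCokernel (V n)) h₁ h₂
    (complexOfFunctor F) (complexOfFunctorHomologyIso F)
  obtain ⟨g, hg⟩ := sumCx.exists_quasiIso hm (fun n => resIsCokernel (V n)) h₁ h₂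
    (zeroCx V) (zeroCxHomologyIso V)
  exact ⟨_, f, g, hf, hg⟩

lemma quasiIso_asFunctor_map_app {K L : CochainComplex (ℤ ⥤ C) ℤ} (f : K ⟶ L) [QuasiIso f]
    (t : ℤ) : QuasiIso ((HomologicalComplex.complexOfFunctorsToFunctorToComplex.map f).app t) :=
  (HomologicalComplex.quasiIso_iff_evaluation f).1 ‹_› t

/-- Formality: if all objects of `C` are projective, a persistence complex which is constant between
consecutive integers is weakly equivalent to its cohomology with zero differential. -/
lemma weaklyEquivalent_zeroCx [HasCoproducts.{0} C] (hC : ∀ X : C, Projective X)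
    (F : ℤ ⥤ CochainComplex C ℤ) :
    WeaklyEquivalent (HomologicalComplex.quasiIso C (ComplexShape.up ℤ)) (floorFunctor ⋙ F)
      (floorFunctor ⋙ (zeroCx fun n =>
        F ⋙ HomologicalComplex.homologyFunctor C (ComplexShape.up ℤ) n).asFunctor) := by
  obtain ⟨P, f, g, hf, hg⟩ := exists_roof hC F
  refine .trans _ (floorFunctor ⋙ P.asFunctor) _ (.symm _ _ (.rel _ _ ?_)) (.rel _ _ ?_)
  · refine ⟨Functor.whiskerLeft floorFunctor
      (HomologicalComplex.complexOfFunctorsToFunctorToComplex.map f ≫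
        (asFunctorComplexOfFunctorIso F).hom), fun r => ?_⟩
    have := quasiIso_asFunctor_map_app f ⌊r⌋
    have h : QuasiIso ((asFunctorComplexOfFunctorIso F).app ⌊r⌋).hom := inferInstance
    exact quasiIso_comp _ _ (hφ := this) (hφ' := h)
  · exact ⟨Functor.whiskerLeft floorFunctor
      (HomologicalComplex.complexOfFunctorsToFunctorToComplex.map g),
        fun r => quasiIso_asFunctor_map_app g ⌊r⌋⟩

/-- Complexes with zero differential may be interleaved degree by degree. -/
lemma interleaved_zeroCx {ε : ℝ≥0} {V V' : ℤ → ℤ ⥤ C}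
    (h : ∀ n, Interleaved ε (floorFunctor ⋙ V n) (floorFunctor ⋙ V' n)) :
    Interleaved ε (floorFunctor ⋙ (zeroCx V).asFunctor)
      (floorFunctor ⋙ (zeroCx V').asFunctor) := by
  simp only [interleaved_iff] at h ⊢
  choose φ ψ n h₁ h₂ using h
  refine ⟨fun a => ⟨fun l => φ l a, fun i j _ => comp_zero.trans zero_comp.symm⟩,
    fun a => ⟨fun l => ψ l a, fun i j _ => comp_zero.trans zero_comp.symm⟩,
    ⟨fun a b h => ?_, fun a b h => ?_⟩, fun a => ?_, fun a => ?_⟩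
  · ext l
    exact (n l).1 a b h
  · ext l
    exact (n l).2 a b h
  · ext l
    exact h₁ l a
  · ext l
    exact h₂ l a

end Persistence

/-! ### The cohomology of the shifts of a dg module -/

section Homology

variable {K : Type u} [Field K]

lemma homologyMap_homologyIsoSc' {X Y : CochainComplex (ModuleCat.{u} K) ℤ} (f : X ⟶ Y)
    (i j k : ℤ) (hi : (ComplexShape.up ℤ).prev j = i) (hk : (ComplexShape.up ℤ).next j = k) :
    HomologicalComplex.homologyMap f j ≫ (Y.homologyIsoSc' i j k hi hk).hom =
      (X.homologyIsoSc' i j k hi hk).hom ≫ ShortComplex.homologyMap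
        ((HomologicalComplex.shortComplexFunctor' _ _ i j k).map f) := by
  have nat : (HomologicalComplex.shortComplexFunctor _ _ j).map f ≫ (Y.isoSc' i j k hi hk).hom =
      (X.isoSc' i j k hi hk).hom ≫ (HomologicalComplex.shortComplexFunctor' _ _ i j k).map f :=
    (HomologicalComplex.natIsoSc' _ _ i j k hi hk).hom.naturality f
  refine (ShortComplex.homologyMap_comp _ _).symm.trans
    (Eq.trans ?_ (ShortComplex.homologyMap_comp _ _))
  exact congrArg (fun g => ShortComplex.homologyMap g) nat

namespace DGPolyMod

variable (M : DGPolyMod K)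

/-- Multiplication by `u` on `M^i ⟶ M^j ⟶ M^k`. -/
def actSc' (i j k : ℤ) : M.cx.sc' i j k ⟶ M.cx.sc' (i + 2) (j + 2) (k + 2) where
  τ₁ := M.act i
  τ₂ := M.act j
  τ₃ := M.act k
  comm₁₂ := M.act_d _ _
  comm₂₃ := M.act_d _ _

/-- The map `M^i ⟶ M^j ⟶ M^k` to `M^i' ⟶ M^j' ⟶ M^k'` given by equalities of the degrees. -/
def scEq {i j k i' j' k' : ℤ} (hi : i = i') (hj : j = j') (hk : k = k') :
    M.cx.sc' i j k ⟶ M.cx.sc' i' j' k' where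
  τ₁ := (M.cx.XIsoOfEq hi).hom
  τ₂ := (M.cx.XIsoOfEq hj).hom
  τ₃ := (M.cx.XIsoOfEq hk).hom

lemma prev_eq {i j : ℤ} (h : i + 1 = j) : (ComplexShape.up ℤ).prev j = i := by
  rw [CochainComplex.prev]; omega

lemma next_eq {j k : ℤ} (h : j + 1 = k) : (ComplexShape.up ℤ).next j = k := by
  rw [CochainComplex.next]; omega

/-- The cohomology of `M^i ⟶ M^j ⟶ M^k`, for consecutive degrees, is `H^j(M)`. -/
def homologyScIso {i j k : ℤ} (hi : i + 1 = j) (hk : j + 1 = k) :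
    (M.cx.sc' i j k).homology ≅ M.H.X j :=
  (M.cx.homologyIsoSc' i j k (prev_eq hi) (next_eq hk)).symm

lemma homologyMap_scEq {i j k i' j' k' : ℤ} (hi : i = i') (hj : j = j') (hk : k = k')
    (h₁ : i + 1 = j) (h₂ : j + 1 = k) (h₁' : i' + 1 = j') (h₂' : j' + 1 = k') :
    ShortComplex.homologyMap (M.scEq hi hj hk) ≫ (M.homologyScIso h₁' h₂').hom =
      (M.homologyScIso h₁ h₂).hom ≫ eqToHom (congrArg M.H.X hj) := by
  subst hi hj hk
  have : M.scEq rfl rfl rfl = 𝟙 (M.cx.sc' i j k) := by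
    ext : 1 <;> exact rfl
  rw [this, ShortComplex.homologyMap_id, Category.id_comp, eqToHom_refl, Category.comp_id]

/-- The action of `u` on `H(M)`, which is defined with the terms in degrees `j - 1`, `j`, `j + 1`,
for an arbitrary presentation `i`, `j`, `k` of these degrees. -/
lemma homologyMap_actSc' {i j k : ℤ} (hi : i + 1 = j) (hk : j + 1 = k)
    (hi' : i + 2 + 1 = j + 2) (hk' : j + 2 + 1 = k + 2) :
    ShortComplex.homologyMap (M.actSc' i j k) ≫ (M.homologyScIso hi' hk').hom =
      (M.homologyScIso hi hk).hom ≫ M.H.act j := by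
  obtain rfl : i = j - 1 := by omega
  subst hk
  exact (Iso.inv_hom_id_assoc _ _).symm

/-- The cohomology of `Σ^{2i} M` in degree `n`, in terms of `M`. -/
def evenShiftScIso (i n : ℤ) : (M.evenShift i).homology n ≅
    (M.cx.sc' (n - 1 + 2 * i) (n + 2 * i) (n + 1 + 2 * i)).homology :=
  (M.evenShift i).homologyIsoSc' (n - 1) n (n + 1) (prev_eq (by ring)) (next_eq rfl)

lemma homologyMap_step_evenShiftScIso (i n : ℤ) : HomologicalComplex.homologyMap (M.step i) n ≫
      (M.evenShiftScIso (i + 1) n).hom =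
    (M.evenShiftScIso i n).hom ≫
      ShortComplex.homologyMap (M.actSc' (n - 1 + 2 * i) (n + 2 * i) (n + 1 + 2 * i)) ≫
        ShortComplex.homologyMap (M.scEq (by ring) (by ring) (by ring)) :=
  (homologyMap_homologyIsoSc' (M.step i) _ _ _ _ _).trans
    (congrArg ((M.evenShiftScIso i n).hom ≫ ·) (ShortComplex.homologyMap_comp
      (M.actSc' (n - 1 + 2 * i) (n + 2 * i) (n + 1 + 2 * i))
      (M.scEq (by ring) (by ring) (by ring))))

/-- The identification `H^n(Σ^{2i} M) ≅ H^{n+2i}(M)`. -/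
def evenShiftHomologyIso (i n : ℤ) : (M.evenShift i).homology n ≅ M.H.X (n + 2 * i) :=
  M.evenShiftScIso i n ≪≫ M.homologyScIso (by ring) (by ring)

/-- On cohomology, `Σ^{2i} M ⟶ Σ^{2(i+1)} M` is the action of `u` on `H(M)`. -/
lemma homologyMap_step (i n : ℤ) : HomologicalComplex.homologyMap (M.step i) n ≫
      (M.evenShiftHomologyIso (i + 1) n).hom =
    (M.evenShiftHomologyIso i n).hom ≫ M.H.act (n + 2 * i) ≫
      eqToHom (congrArg M.H.X (by ring)) := by
  simp only [evenShiftHomologyIso, Iso.trans_hom, Category.assoc]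
  rw [← Category.assoc, homologyMap_step_evenShiftScIso, Category.assoc, Category.assoc,
    M.homologyMap_scEq (by ring) (by ring) (by ring) (by ring) (by ring),
    ← Category.assoc (ShortComplex.homologyMap _), M.homologyMap_actSc', Category.assoc]

/-- The identification `H^n(Σ^{2i} M) ≅ (S^k H(M))^{i+m}`, for `n = 2m + k`. -/
def evenShiftSIso {n m k : ℤ} (h : n = 2 * m + k) (i : ℤ) :
    (M.evenShift i).homology n ≅ (M.H.S k).X (i + m) :=
  M.evenShiftHomologyIso i n ≪≫
    eqToIso (congrArg M.H.X (show n + 2 * i = 2 * (i + m) + k by rw [h]; ring))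

lemma homologyMap_step_eqToHom {n p q : ℤ} (i : ℤ) (h : n + 2 * i = p)
    (h' : n + 2 * (i + 1) = q) :
    HomologicalComplex.homologyMap (M.step i) n ≫
        (M.evenShiftHomologyIso (i + 1) n ≪≫ eqToIso (congrArg M.H.X h')).hom =
      (M.evenShiftHomologyIso i n ≪≫ eqToIso (congrArg M.H.X h)).hom ≫ M.H.act p ≫
        eqToHom (congrArg M.H.X (show p + 2 = q by rw [← h, ← h']; ring)) := by
  subst h h'
  simpa using M.homologyMap_step i n

lemma homologyMap_step_evenShiftSIso {n m k : ℤ} (h : n = 2 * m + k) (i : ℤ) :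
    HomologicalComplex.homologyMap (M.step i) n ≫ (M.evenShiftSIso h (i + 1)).hom =
      (M.evenShiftSIso h i).hom ≫ (M.H.S k).act (i + m) ≫
        eqToHom (congrArg (M.H.S k).X (show i + m + 1 = i + 1 + m by ring)) := by
  refine (M.homologyMap_step_eqToHom i (show n + 2 * i = 2 * (i + m) + k by rw [h]; ring)
    (show n + 2 * (i + 1) = 2 * (i + 1 + m) + k by rw [h]; ring)).trans
      (congrArg ((M.evenShiftSIso h i).hom ≫ ·) ?_)
  have hX : ∀ {a b c : ℤ} (h : a = b) (h' : b = c), eqToHom (congrArg M.H.X h) ≫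
    eqToHom (congrArg M.H.X h') = eqToHom (congrArg M.H.X (h.trans h')) := by simp
  exact (congrArg (M.H.act (2 * (i + m) + k) ≫ ·) 
    (hX (show 2 * (i + m) + k + 2 = 2 * (i + m + 1) + k by ring)
      (show 2 * (i + m + 1) + k = 2 * (i + 1 + m) + k by ring)).symm).trans
    (Category.assoc _ _ _).symm

/-- The translation of `(ℤ, ≤)` by `m`. -/
def addZ (m : ℤ) : ℤ ⥤ ℤ :=
  Monotone.functor (f := fun a : ℤ => a + m) fun _ _ h => Int.add_le_add_right h m

/-- The cohomology of degree `2m + k` of the persistence complex of `M` is the graded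
`K[t]`-module `S^k H(M)`, translated by `m`. -/
def homologyFunctorIso {n m k : ℤ} (h : n = 2 * m + k) :
    M.C ⋙ HomologicalComplex.homologyFunctor _ (ComplexShape.up ℤ) n ≅
      addZ m ⋙ (M.H.S k).toPersZ :=
  natIsoOfSteps (fun i => M.evenShiftSIso h i) fun i => by
    have e₁ : M.C.map (homOfLE (int_le_succ i)) = M.step i := ofSteps_map_step _ i
    have e₂ : (M.H.S k).toPersZ.map (homOfLE (Int.add_le_add_right (int_le_succ i) m)) =
        (M.H.S k).act (i + m) ≫ eqToHom (congrArg (M.H.S k).X (by ring)) :=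
      ofSteps_map_of_eq _ (show i + m + 1 = i + 1 + m by ring) _
    refine (congrArg (fun f => HomologicalComplex.homologyMap f n ≫ _) e₁).trans ?_
    exact (M.homologyMap_step_evenShiftSIso h i).trans (congrArg (_ ≫ ·) e₂.symm)

end DGPolyMod
end Homology

/-! ### The distances of the persistence dg modules -/

section Distances

variable {K : Type u} [Field K]

/-- Over `(ℝ, ≤)`, translating by an integer commutes with the floor function. -/
def floorAddIso (m : ℤ) : floorFunctor ⋙ DGPolyMod.addZ m ≅ addFunctor (m : ℝ) ⋙ floorFunctor :=
  NatIso.ofComponents (fun r => eqToIso (Int.floor_add_intCast (r : ℝ) m).symm)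
    (fun _ => Subsingleton.elim _ _)

/-- The cohomology of degree `2m + k` of `αM`, as a persistence vector space. -/
def αHomologyIso (M : DGPolyMod K) {n m k : ℤ} (h : n = 2 * m + k) :
    M.α ⋙ HomologicalComplex.homologyFunctor _ (ComplexShape.up ℤ) n ≅
      addFunctor (m : ℝ) ⋙ (M.H.S k).toPersR :=
  Functor.isoWhiskerLeft floorFunctor (M.homologyFunctorIso h) ≪≫
    Functor.isoWhiskerRight (floorAddIso m) (M.H.S k).toPersZ

lemma homologyFunctor_inverts (K : Type u) [Field K] (n : ℤ) : (qis K).IsInvertedBy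
    (HomologicalComplex.homologyFunctor (ModuleCat.{u} K) (ComplexShape.up ℤ) n) :=
  fun X Y f (hf : QuasiIso f) => by
    change IsIso (HomologicalComplex.homologyMap f n)
    infer_instance

/-- The cohomology functor on the homotopy category of complexes. -/
def hoHomology (K : Type u) [Field K] (n : ℤ) : (qis K).Localization ⥤ ModuleCat.{u} K :=
  Localization.lift (HomologicalComplex.homologyFunctor _ (ComplexShape.up ℤ) n)
    (homologyFunctor_inverts K n) (qis K).Q

/-- On complexes, `hoHomology` is the usual cohomology functor. -/
def hoHomologyIso (K : Type u) [Field K] (n : ℤ) :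
    (qis K).Q ⋙ hoHomology K n ≅ HomologicalComplex.homologyFunctor _ (ComplexShape.up ℤ) n :=
  Localization.fac _ (homologyFunctor_inverts K n) (qis K).Q

/-- The translation by `0` may be dropped. -/
def addFunctorZeroIso {C : Type*} [Category* C] (F : ℝ ⥤ C) :
    addFunctor ((0 : ℤ) : ℝ) ⋙ F ≅ F :=
  Functor.isoWhiskerRight (NatIso.ofComponents (G := 𝟭 ℝ)
    (fun r => eqToIso (show (r : ℝ) + ((0 : ℤ) : ℝ) = r by simp))
    (fun _ => Subsingleton.elim _ _)) F ≪≫ F.leftUnitor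

/-- Cohomology factors through the homotopy category, hence takes homotopy commutative
interleavings to interleavings. -/
lemma HomotopyCommInterleaved.toPersR {ε : ℝ≥0} {M N : DGPolyMod K}
    (h : HomotopyCommInterleaved (qis K) ε M.α N.α) (k : ℤ) :
    Interleaved ε (M.H.S k).toPersR (N.H.S k).toPersR := by
  have e : ∀ M : DGPolyMod K, (M.α ⋙ (qis K).Q) ⋙ hoHomology K k ≅ (M.H.S k).toPersR := fun M =>
    Functor.associator _ _ _ ≪≫ Functor.isoWhiskerLeft M.α (hoHomologyIso K k) ≪≫
      αHomologyIso M (show k = 2 * 0 + k by ring) ≪≫ addFunctorZeroIso _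
  exact (Interleaved.comp h (hoHomology K k)).of_iso (e M) (e N)

lemma dCohI_le_dHC (k : ℤ) (M N : DGPolyMod K) : dCohI k M N ≤ dHC (qis K) M.α N.α :=
  le_iInf₂ fun ε h => iInf₂_le ε (h.toPersR k)

/-- By formality, interleavings of the even and the odd cohomology give a homotopy interleaving. -/
lemma homotopyInterleaved_of_toPersR {ε : ℝ≥0} {M N : DGPolyMod K}
    (h₀ : Interleaved ε (M.H.S 0).toPersR (N.H.S 0).toPersR)
    (h₁ : Interleaved ε (M.H.S 1).toPersR (N.H.S 1).toPersR) :
    HomotopyInterleaved (qis K) ε M.α N.α := by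
  have hC : ∀ X : ModuleCat.{u} K, Projective X := fun X => by
    have : Module.Free K X := Module.Free.of_divisionRing K X
    have : Module.Projective K X := Module.Projective.of_free
    exact ModuleCat.projective_of_categoryTheory_projective X
  refine ⟨_, _, weaklyEquivalent_zeroCx hC M.C, weaklyEquivalent_zeroCx hC N.C,
    interleaved_zeroCx fun n => ?_⟩
  obtain ⟨m, k, hn, hk⟩ : ∃ m k : ℤ, n = 2 * m + k ∧ (k = 0 ∨ k = 1) :=
    ⟨n / 2, n % 2, by omega, by omega⟩
  have h : Interleaved ε (M.H.S k).toPersR (N.H.S k).toPersR := by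
    rcases hk with rfl | rfl
    · exact h₀
    · exact h₁
  exact (h.addFunctor_comp (m : ℝ)).of_iso (αHomologyIso M hn).symm (αHomologyIso N hn).symm

lemma dHI_le_max (M N : DGPolyMod K) :
    dHI (qis K) M.α N.α ≤ max (dCohI 0 M N) (dCohI 1 M N) := by
  refine le_of_not_gt fun h => ?_
  obtain ⟨h₀, h₁⟩ := max_lt_iff.1 h
  simp only [dCohI, dI, iInf_lt_iff] at h₀ h₁
  obtain ⟨ε₀, i₀, h₀⟩ := h₀
  obtain ⟨ε₁, i₁, h₁⟩ := h₁
  have hi := homotopyInterleaved_of_toPersR (i₀.mono (le_max_left ε₀ ε₁))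
    (i₁.mono (le_max_right ε₀ ε₁))
  have hle : dHI (qis K) M.α N.α ≤ ((max ε₀ ε₁ : ℝ≥0) : ℝ≥0∞) := iInf₂_le (max ε₀ ε₁) hi
  rw [ENNReal.coe_max] at hle
  exact absurd (max_lt h₀ h₁) (not_lt.2 hle)

end Distances

/-! ### Barcodes -/

section Barcodes

open Limits

variable {K : Type u} [Field K]

/-- The persistence vector space of a graded `K[t]`-module with barcode `B` is `χ(B)`. The
restriction of `χ_J` along the floor function is the interval module of `{x ∣ ⌊x⌋ ∈ J}` by
definition. -/
def Barcode.toPersRIso (B : Barcode.{u}) {V : GrPolyMod K 1}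
    (e : V.toPersZ ≅ ∐ fun i : B.ι => chi K (B.supp i) (B.ordConnected i)) :
    V.toPersR ≅ B.χ K :=
  Functor.isoWhiskerLeft floorFunctor e ≪≫
    PreservesCoproduct.iso ((Functor.whiskeringLeft ℝ ℤ (ModuleCat.{u} K)).obj floorFunctor) _

end Barcodes

end Pers

end

theorem mainTheorem2 (K : Type u) [Field K] (M N : Pers.DGPolyMod K) :
    Pers.dHC (Pers.qis K) M.α N.α = max (Pers.dCohI 0 M N) (Pers.dCohI 1 M N) ∧
    Pers.dIHC (Pers.qis K) M.α N.α = max (Pers.dCohI 0 M N) (Pers.dCohI 1 M N) ∧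
    Pers.dHI (Pers.qis K) M.α N.α = max (Pers.dCohI 0 M N) (Pers.dCohI 1 M N) ∧
    ∀ (k : ℤ) (B B' : Pers.Barcode.{u}), k = 0 ∨ k = 1 →
      B.IsBarcodeOf (M.H.S k) → B'.IsBarcodeOf (N.H.S k) →
        Pers.dCohI k M N = Pers.dI (B.χ K) (B'.χ K) := by
  have h₁ := max_le (Pers.dCohI_le_dHC 0 M N) (Pers.dCohI_le_dHC 1 M N)
  have h₂ := Pers.dHC_le_dIHC (Pers.qis K) M.α N.α
  have h₃ := Pers.dIHC_le_dHI (Pers.qis K) M.α N.α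
  have h₄ := Pers.dHI_le_max M N
  refine ⟨le_antisymm (h₂.trans (h₃.trans h₄)) h₁, le_antisymm (h₃.trans h₄) (h₁.trans h₂),
    le_antisymm h₄ (h₁.trans (h₂.trans h₃)), ?_⟩
  rintro k B B' - ⟨e⟩ ⟨e'⟩
  exact Pers.dI_congr (B.toPersRIso e) (B'.toPersRIso e')
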